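/- A time series is a finite sequence $x=(x_1,\dots,x_n)$ of real numbers. Fix a constant $c\ge 0$. There are three transformation operations: a move replaces a point $x_i$ by $x_i+w$ for some $w\in\mathbb R$ ($w=0$ is allowed), at cost $|w|$; a split replaces $x_i$ by two consecutive copies of $x_i$, at cost $c$; a merge replaces two consecutive points of equal value by a single point of that value, at cost $c$. A transformation of $x$ to $y$ is a finite sequence of operations that, applied successively, turns $x$ into $y$; its cost is the sum of the costs of its operations, and it is optimal if no transformation of $x$ to $y$ has smaller cost. The transformation graph of a transformation of $x$ to $y$ is a directed graph. It has one source node for each point $x_i$, and each operation adds new nodes for the points it creates and edges from the nodes of the points it acts on: one move edge, two split edges (from one node to two new nodes), or two merge edges (from two nodes to one new node). The nodes of the final series $y$ are the sink nodes. For a weakly connected component $\mathcal T$, let $N_{\mathcal T}(x)$ be the set of its source nodes. * A component is a Type-1-Tree if it consists of exactly one move edge, joining one source node to one sink node. * A component is a Type-4-Tree if it is a tree (as an undirected graph), has at least two source nodes and at least two sink nodes, and on every directed path from a source node to a sink node the sequence of edge kinds consists of a (possibly empty) sequence of merges and moves, followed by merge, move, split, followed by a (possibly empty) sequence of splits and moves.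 **Statement.** Let $x=(x_1,\dots,x_n)$ be a time series, let $c\ge 0$ and $q$ be real numbers, and let $q^{(n)}=(q,\dots,q)$ be the constant time series of length $n$. Put $t^+=q+2c$ and $t^-=q-2c$. Then there exists an optimal transformation of $x$ to $q^{(n)}$ such that each weakly connected component $\mathcal T$ of its transformation graph is 1. a Type-4-Tree with $|N_{\mathcal T}(x)|>1$ such that either $x_j\le t^-$ for all source nodes $u_j\in N_{\mathcal T}(x)$, or $x_j\ge t^+$ for all source nodes $u_j\in N_{\mathcal T}(x)$ (where $u_j$ is the source node of the point $x_j$), or 2. a Type-1-Tree. -/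

import Mathlib

noncomputable section

namespace MSM

/-! ### Move, split and merge operations

A time series is a list of real numbers; positions are counted from `0`. -/

/-- The three transformation operations. -/
inductive Op where
  | move (i : ℕ) (w : ℝ)
  | split (i : ℕ)
  | merge (i : ℕ)

/-- A move by `w` costs `|w|`; a split and a merge cost `c` each. -/
def Op.cost (c : ℝ) : Op → ℝ
  | .move _ w => |w|
  | .split _ => c
  | .merge _ => c

/-- `Step o x y`: the operation `o` is applicable to `x` and its result is `y`.
A merge is applicable only to two consecutive points of equal value. -/
inductive Step : Op → List ℝ → List ℝ → Prop where
  | move (l r : List ℝ) (a w : ℝ) :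
      Step (.move l.length w) (l ++ a :: r) (l ++ (a + w) :: r)
  | split (l r : List ℝ) (a : ℝ) :
      Step (.split l.length) (l ++ a :: r) (l ++ a :: a :: r)
  | merge (l r : List ℝ) (a : ℝ) :
      Step (.merge l.length) (l ++ a :: a :: r) (l ++ a :: r)

/-- `Transforms S x y`: the operations in `S`, applied one after the other, transform `x` to `y`. -/
inductive Transforms : List Op → List ℝ → List ℝ → Prop where
  | nil (x : List ℝ) : Transforms [] x x
  | cons {o : Op} {S : List Op} {x y z : List ℝ} :
      Step o x y → Transforms S y z → Transforms (o :: S) x z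

/-- The cost of a sequence of operations is the sum of the costs of its members. -/
def cost (c : ℝ) (S : List Op) : ℝ := (S.map (Op.cost c)).sum

/-- `S` transforms `x` to `y`, and no sequence of operations does so at a smaller cost. -/
def IsOptimal (c : ℝ) (S : List Op) (x y : List ℝ) : Prop :=
  Transforms S x y ∧ ∀ S' : List Op, Transforms S' x y → cost c S ≤ cost c S'

/-! ### Transformation graphs -/

/-- A node carries an identifier, unique within its graph, and the value of the point that it
represents. -/
@[ext]
structure Node where
  id : ℕ
  val : ℝ

/-- The kinds of edges. -/
inductive Kind where
  | move
  | split
  | merge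

/-- A directed edge together with its kind. -/
@[ext]
structure Edge where
  src : Node
  tgt : Node
  kind : Kind

/-- A transformation graph. The list `sources` holds the nodes of the initial time series, and
`sinks` those of the time series that has been reached, both from left to right. -/
structure Graph where
  nodes : List Node
  edges : List Edge
  sources : List Node
  sinks : List Node

/-- The graph of the empty sequence of operations: one node for each point of `x`. -/
def Graph.init (x : List ℝ) : Graph where
  nodes := x.mapIdx Node.mk
  edges := []
  sources := x.mapIdx Node.mk
  sinks := x.mapIdx Node.mk

/-- Record one more operation. A move adds a new node and a move edge, a split adds two new nodes
and two split edges, and a merge adds a new node and two merge edges. The untouched points keep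
their nodes. (Nothing is recorded at a position that does not exist.) -/
def Graph.record (G : Graph) : Op → Graph
  | .move i w =>
    match G.sinks.drop i with
    | u :: r =>
      let v : Node := ⟨G.nodes.length, u.val + w⟩
      { nodes := G.nodes ++ [v]
        edges := G.edges ++ [⟨u, v, .move⟩]
        sources := G.sources
        sinks := G.sinks.take i ++ v :: r }
    | _ => G
  | .split i =>
    match G.sinks.drop i with
    | u :: r =>
      let v₁ : Node := ⟨G.nodes.length, u.val⟩
      let v₂ : Node := ⟨G.nodes.length + 1, u.val⟩
      { nodes := G.nodes ++ [v₁, v₂]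
        edges := G.edges ++ [⟨u, v₁, .split⟩, ⟨u, v₂, .split⟩]
        sources := G.sources
        sinks := G.sinks.take i ++ v₁ :: v₂ :: r }
    | _ => G
  | .merge i =>
    match G.sinks.drop i with
    | u₁ :: u₂ :: r =>
      let v : Node := ⟨G.nodes.length, u₁.val⟩
      { nodes := G.nodes ++ [v]
        edges := G.edges ++ [⟨u₁, v, .merge⟩, ⟨u₂, v, .merge⟩]
        sources := G.sources
        sinks := G.sinks.take i ++ v :: r }
    | _ => G

/-- The transformation graph of the sequence `S` of operations, applied to `x`. -/
def transformationGraph (x : List ℝ) (S : List Op) : Graph :=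
  S.foldl Graph.record (Graph.init x)

/-- `G.Path u v ks`: there is a directed path from `u` to `v` whose edges have, in this order, the
kinds `ks`. -/
inductive Graph.Path (G : Graph) : Node → Node → List Kind → Prop where
  | nil (u : Node) : Graph.Path G u u []
  | cons {u v w : Node} {k : Kind} {ks : List Kind} :
      ⟨u, v, k⟩ ∈ G.edges → Graph.Path G v w ks → Graph.Path G u w (k :: ks)

/-- The underlying undirected graph. -/
def Graph.undirected (G : Graph) : SimpleGraph Node :=
  SimpleGraph.fromRel fun u v => ∃ k : Kind, (⟨u, v, k⟩ : Edge) ∈ G.edges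

/-- The weakly connected component of `u`. -/
abbrev Graph.component (G : Graph) (u : Node) : G.undirected.ConnectedComponent :=
  G.undirected.connectedComponentMk u

/-- The source nodes in a weakly connected component. -/
def Graph.sourcesIn (G : Graph) (C : G.undirected.ConnectedComponent) : Set Node :=
  {u | u ∈ G.sources ∧ u ∈ C.supp}

/-- The sink nodes in a weakly connected component. -/
def Graph.sinksIn (G : Graph) (C : G.undirected.ConnectedComponent) : Set Node :=
  {u | u ∈ G.sinks ∧ u ∈ C.supp}

/-- The edges in a weakly connected component. -/
def Graph.edgesIn (G : Graph) (C : G.undirected.ConnectedComponent) : Set Edge :=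
  {e | e ∈ G.edges ∧ e.src ∈ C.supp}

/-- Type 1 paths: move - ... - move. -/
def IsType1Path (ks : List Kind) : Prop :=
  ks ≠ [] ∧ ∀ k ∈ ks, k = .move

/-- Type 4 paths: merge/move - ... - merge/move, then merge - move - split, then
split/move - ... - split/move, where the first and the last part may be empty. -/
def IsType4Path (ks : List Kind) : Prop :=
  ∃ as bs : List Kind,
    ks = as ++ [.merge, .move, .split] ++ bs ∧
      (∀ k ∈ as, k = .merge ∨ k = .move) ∧ (∀ k ∈ bs, k = .split ∨ k = .move)

/-- A Type-1-Tree: all paths from a source to a sink are of Type 1, and the tree consists of a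
single move edge that connects its one source with its one sink. -/
def Graph.IsType1Tree (G : Graph) (C : G.undirected.ConnectedComponent) : Prop :=
  C.toSimpleGraph.IsTree ∧
    (∀ u ∈ G.sourcesIn C, ∀ v ∈ G.sinksIn C, ∀ ks, G.Path u v ks → IsType1Path ks) ∧
    ∃ u v : Node, G.sourcesIn C = {u} ∧ G.sinksIn C = {v} ∧ G.edgesIn C = {⟨u, v, .move⟩}

/-- A Type-4-Tree: all paths from a source to a sink are of Type 4, and there are at least two
sources and at least two sinks. -/
def Graph.IsType4Tree (G : Graph) (C : G.undirected.ConnectedComponent) : Prop :=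
  C.toSimpleGraph.IsTree ∧
    (∀ u ∈ G.sourcesIn C, ∀ v ∈ G.sinksIn C, ∀ ks, G.Path u v ks → IsType4Path ks) ∧
    2 ≤ (G.sourcesIn C).ncard ∧ 2 ≤ (G.sinksIn C).ncard

end MSM

end

/-!
The cost of an optimal transformation is computed by a potential, and the transformation built here
attains it.

Let `capped t = min |t - q| (2c)`, and let `excess t` be the signed part of `t - q` beyond the
threshold `2c`. The potential of a series `y` is the sum of `capped yᵢ` plus half of the total
variation of `0, excess y₁, …, excess yₙ, 0`. A move by `w` changes it by at most `|w|`; a split or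
merge at `t` changes it by `capped t ≤ 2c`. Hence the potential minus `c` times the length drops by
at most the cost of an operation (`potential_sub_length_step_le`). Since `q, …, q` has potential `0`
and the length of `x`, no transformation is cheaper than the potential of `x` (`potential_le_cost`).

Equality is attained as follows. While two neighbours lie strictly beyond the threshold on the same
side of `q`, such a run has a peak, and lowering a peak to its higher neighbour and merging the two
lowers the corrected potential by exactly the cost of these operations (`exists_tight_merge`,
`exists_gathersTo`). When no such neighbours are left, the variation is twice the sum of the absolute excesses, so that the potential is the sum of the
distances to `q` (`potential_of_isChain`). Each remaining point is then moved to `q` and split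
once for every merge in its component (`Spreading.exists_final`).

For the graph, a labelling that is constant along edges and chooses a reachable representative of
each component describes the components (`Forest.mem_component_iff`). Acyclicity persists because
each operation adds leaves, except for a merge, which in addition joins two components
(`Forest.addLeaf`, `Forest.join`). The shape of the paths is read off from a stage attached to each
node (`StagedForest.path_kinds`): points that were never merged give Type-1-Trees, the others
Type-4-Trees, and a merge only ever combines points beyond the threshold on one side.
-/

noncomputable section

namespace MSM

/-! ### The potential of a time series -/

/-- The part of the distance of `t` to `q` that lies within the threshold `2 * c`. -/
def capped (c q t : ℝ) : ℝ := min |t - q| (2 * c)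

/-- The signed part of `t - q` that exceeds the threshold `2 * c` (soft thresholding). -/
def excess (c q t : ℝ) : ℝ := max (t - q - 2 * c) 0 + min (t - q + 2 * c) 0

/-- The total variation of the sequence `f p, f y₁, …, f yₙ, 0`. -/
def variation (f : ℝ → ℝ) : ℝ → List ℝ → ℝ
  | p, [] => |f p|
  | p, t :: r => |f t - f p| + variation f t r

/-- The distance of `y` to the constant series `q` of the same length: the capped distances plus
half of the total variation of the excesses, extended by `0` at both ends (note that the excess of
`q` vanishes). -/
def potential (c q : ℝ) (y : List ℝ) : ℝ :=
  (y.map (capped c q)).sum + variation (excess c q) q y / 2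

section Values

variable {c q : ℝ}

theorem excess_self (hc : 0 ≤ c) : excess c q q = 0 := by
  rw [excess, max_eq_right (by linarith), min_eq_right (by linarith), add_zero]

theorem excess_cases (hc : 0 ≤ c) (t : ℝ) :
    (q + 2 * c < t ∧ excess c q t = t - q - 2 * c ∧ capped c q t = 2 * c) ∨
    (|t - q| ≤ 2 * c ∧ excess c q t = 0 ∧ capped c q t = |t - q|) ∨
    (t < q - 2 * c ∧ excess c q t = t - q + 2 * c ∧ capped c q t = 2 * c) := by
  unfold excess capped
  rcases lt_or_ge (q + 2 * c) t with h | h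
  · refine .inl ⟨h, ?_, ?_⟩
    · rw [max_eq_left (by linarith), min_eq_right (by linarith)]; ring
    · rw [abs_of_pos (by linarith), min_eq_right (by linarith)]
  rcases lt_or_ge t (q - 2 * c) with h' | h'
  · refine .inr (.inr ⟨h', ?_, ?_⟩)
    · rw [max_eq_right (by linarith), min_eq_left (by linarith)]; ring
    · rw [abs_of_neg (by linarith), min_eq_right (by linarith)]
  · have : |t - q| ≤ 2 * c := abs_le.2 ⟨by linarith, by linarith⟩
    refine .inr (.inl ⟨this, ?_, min_eq_left this⟩)
    rw [max_eq_right (by linarith), min_eq_right (by linarith), add_zero]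

theorem capped_nonneg (hc : 0 ≤ c) (t : ℝ) : 0 ≤ capped c q t :=
  le_min (abs_nonneg _) (by linarith)

theorem capped_le (t : ℝ) : capped c q t ≤ 2 * c := min_le_right _ _

theorem capped_add_abs_excess (hc : 0 ≤ c) (t : ℝ) :
    capped c q t + |excess c q t| = |t - q| := by
  rcases excess_cases (q := q) hc t with ⟨h, e, k⟩ | ⟨h, e, k⟩ | ⟨h, e, k⟩ <;> rw [e, k]
  · rw [abs_of_pos (by linarith), abs_of_pos (by linarith)]; ring
  · simp
  · rw [abs_of_neg (by linarith), abs_of_neg (by linarith)]; ring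

theorem capped_sub_add_excess_sub_le (hc : 0 ≤ c) (a b : ℝ) :
    |capped c q b - capped c q a| + |excess c q b - excess c q a| ≤ |b - a| := by
  rcases excess_cases (q := q) hc a with ⟨h, e, k⟩ | ⟨h, e, k⟩ | ⟨h, e, k⟩ <;>
  rcases excess_cases (q := q) hc b with ⟨h', e', k'⟩ | ⟨h', e', k'⟩ | ⟨h', e', k'⟩ <;>
  rw [e, k, e', k'] <;> grind

/-- Two points whose excesses have the same sign lie beyond the threshold on the same side
of `q`. -/
theorem side_of_excess_mul_pos (hc : 0 ≤ c) {a b : ℝ} (h : 0 < excess c q a * excess c q b) :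
    (q + 2 * c < a ∧ q + 2 * c < b) ∨ (a < q - 2 * c ∧ b < q - 2 * c) := by
  rcases excess_cases (q := q) hc a with ⟨h1, e, -⟩ | ⟨h1, e, -⟩ | ⟨h1, e, -⟩ <;>
  rcases excess_cases (q := q) hc b with ⟨h2, e', -⟩ | ⟨h2, e', -⟩ | ⟨h2, e', -⟩ <;>
  rw [e, e'] at h <;> try simp only [mul_zero, zero_mul, lt_irrefl] at h
  · exact .inl ⟨h1, h2⟩
  · nlinarith
  · nlinarith
  · exact .inr ⟨h1, h2⟩

theorem capped_of_excess_ne_zero (hc : 0 ≤ c) {a : ℝ} (h : excess c q a ≠ 0) :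
    capped c q a = 2 * c := by
  rcases excess_cases (q := q) hc a with ⟨-, -, k⟩ | ⟨-, e, -⟩ | ⟨-, -, k⟩
  · exact k
  · exact absurd e h
  · exact k

theorem abs_excess_sub_of_mul_pos (hc : 0 ≤ c) {a b : ℝ}
    (h : 0 < excess c q a * excess c q b) : |excess c q a - excess c q b| = |a - b| := by
  have hs := side_of_excess_mul_pos hc h
  rcases excess_cases (q := q) hc a with ⟨h1, e, -⟩ | ⟨h1, e, -⟩ | ⟨h1, e, -⟩ <;>
  rcases excess_cases (q := q) hc b with ⟨h2, e', -⟩ | ⟨h2, e', -⟩ | ⟨h2, e', -⟩ <;>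
  rw [e, e'] at h ⊢ <;> try simp only [mul_zero, zero_mul, lt_irrefl] at h
  · congr 1; ring
  · rcases hs with hs | hs <;> linarith
  · rcases hs with hs | hs <;> linarith
  · congr 1; ring

end Values

section Variation

variable (f : ℝ → ℝ)

theorem variation_append_move (l r : List ℝ) (a b : ℝ) :
    ∀ p, variation f p (l ++ a :: r) ≤ variation f p (l ++ b :: r) + 2 * |f b - f a| := by
  have key : ∀ r, variation f a r ≤ variation f b r + |f b - f a| := by
    rintro (_ | ⟨t, r⟩)
    · have := abs_sub_abs_le_abs_sub (f a) (f b)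
      rw [abs_sub_comm] at this
      simp only [variation]; linarith
    · have := abs_sub_le (f t) (f b) (f a)
      simp only [variation]; linarith
  induction l with
  | nil =>
    intro p
    have h1 := key r
    have h2 := abs_sub_le (f a) (f b) (f p)
    rw [abs_sub_comm (f a) (f b)] at h2
    simp only [List.nil_append, variation]; linarith
  | cons t l ih =>
    intro p
    simp only [List.cons_append, variation]
    linarith [ih t]

theorem variation_append_dup (l r : List ℝ) (a : ℝ) :
    ∀ p, variation f p (l ++ a :: a :: r) = variation f p (l ++ a :: r) := by
  induction l with
  | nil => intro p; simp [variation]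
  | cons t l ih => intro p; simp [variation, ih t]

/-- Without neighbours of the same sign, every point is a peak of its own. -/
theorem variation_of_isChain :
    ∀ (y : List ℝ) (p : ℝ), (p :: y).IsChain (fun a b => ¬ 0 < f a * f b) →
      variation f p y = |f p| + 2 * (y.map fun t => |f t|).sum
  | [], p, _ => by simp [variation]
  | t :: r, p, h => by
    rw [List.isChain_cons_cons] at h
    have h1 : |f t - f p| = |f t| + |f p| := by
      have h0 : f p * f t ≤ 0 := not_lt.1 h.1
      rcases mul_nonpos_iff.1 h0 with ⟨h2, h3⟩ | ⟨h2, h3⟩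
      · rw [abs_of_nonneg h2, abs_of_nonpos h3, abs_of_nonpos (by linarith)]; ring
      · rw [abs_of_nonpos h2, abs_of_nonneg h3, abs_of_nonneg (by linarith)]; ring
    rw [variation, variation_of_isChain r t h.2, h1, List.map_cons, List.sum_cons]
    ring

/-- A peak next to a point of the same sign can be levelled with one of its neighbours `u`, `v` so
that the variation decreases by exactly twice the height difference. The scan from left to right
ascends from `p` to `b`, so that the next descent reveals a peak. The first alternative merges `b`
into `p`; the second leaves `p` untouched. -/
theorem exists_tight_merge_aux :
    ∀ (r : List ℝ) (p b : ℝ), (0 < f p * f b → |f p| ≤ |f b|) →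
      ¬ (p :: b :: r).IsChain (fun a b => ¬ 0 < f a * f b) →
      (0 < f p * f b ∧ variation f p (b :: r) = variation f p r + 2 * |f p - f b|) ∨
      ∃ l u v r', b :: r = l ++ u :: v :: r' ∧ 0 < f u * f v ∧
        (variation f p (b :: r) = variation f p (l ++ v :: r') + 2 * |f u - f v| ∨
         variation f p (b :: r) = variation f p (l ++ u :: r') + 2 * |f u - f v|)
  | [], p, b, hpb, h => by
    simp only [List.isChain_cons_cons, List.isChain_singleton, and_true, not_not] at h
    refine .inl ⟨h, ?_⟩
    have := hpb h
    simp only [variation]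
    rcases mul_pos_iff.1 h with ⟨h1, h2⟩ | ⟨h1, h2⟩ <;> grind
  | b' :: r, p, b, hpb, h => by
    by_cases hs : 0 < f b * f b'
    · by_cases hle : |f b| ≤ |f b'|
      · -- still ascending
        have h' : ¬ (b :: b' :: r).IsChain (fun a b => ¬ 0 < f a * f b) := by
          rw [List.isChain_cons_cons]; exact fun k => k.1 hs
        rcases exists_tight_merge_aux r b b' (fun _ => hle) h' with
          ⟨_, e⟩ | ⟨l, u, v, r', e, huv, k⟩
        · refine .inr ⟨[], b, b', r, rfl, hs, .inr ?_⟩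
          rw [variation, e, List.nil_append, variation]; ring
        · refine .inr ⟨b :: l, u, v, r', by rw [e]; rfl, huv, ?_⟩
          simp only [List.cons_append, variation] at k ⊢
          rcases k with k | k
          · left; linarith
          · right; linarith
      · -- `b` is a peak; it is lowered to the higher one of its neighbours
        by_cases hp : 0 < f p * f b ∧ |f b'| ≤ |f p|
        · refine .inl ⟨hp.1, ?_⟩
          have := hpb hp.1
          simp only [variation]
          rcases mul_pos_iff.1 hs with ⟨h1, h2⟩ | ⟨h1, h2⟩ <;>
          rcases mul_pos_iff.1 hp.1 with ⟨h3, h4⟩ | ⟨h3, h4⟩ <;> grind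
        · refine .inr ⟨[], b, b', r, rfl, hs, .inl ?_⟩
          simp only [variation, List.nil_append]
          have h0 : 0 < f p * f b → |f p| < |f b'| := fun k => by
            by_contra h'; exact hp ⟨k, not_lt.1 h'⟩
          rw [mul_pos_iff] at h0 hs
          rcases hs with ⟨h1, h2⟩ | ⟨h1, h2⟩ <;> grind
    · by_cases hp : 0 < f p * f b
      · refine .inl ⟨hp, ?_⟩
        have := hpb hp
        simp only [variation]
        rw [not_lt, mul_nonpos_iff] at hs
        rcases mul_pos_iff.1 hp with ⟨h3, h4⟩ | ⟨h3, h4⟩ <;> grind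
      · have h' : ¬ (b :: b' :: r).IsChain (fun a b => ¬ 0 < f a * f b) := by
          rw [List.isChain_cons_cons] at h; exact fun k => h ⟨hp, k⟩
        rcases exists_tight_merge_aux r b b' (fun k => absurd k hs) h' with
          ⟨k, _⟩ | ⟨l, u, v, r', e, huv, k⟩
        · exact absurd k hs
        · refine .inr ⟨b :: l, u, v, r', by rw [e]; rfl, huv, ?_⟩
          simp only [List.cons_append, variation] at k ⊢
          rcases k with k | k
          · left; linarith
          · right; linarith

end Variation

section Potential

variable {c q : ℝ}

theorem potential_append_move_le (hc : 0 ≤ c) (l r : List ℝ) (a b : ℝ) :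
    potential c q (l ++ a :: r) ≤ potential c q (l ++ b :: r) + |b - a| := by
  have h1 := variation_append_move (excess c q) l r a b q
  have h2 := capped_sub_add_excess_sub_le (q := q) hc a b
  have h3 := neg_abs_le (capped c q b - capped c q a)
  simp only [potential, List.map_append, List.map_cons, List.sum_append, List.sum_cons]
  linarith

theorem potential_append_dup (l r : List ℝ) (a : ℝ) :
    potential c q (l ++ a :: a :: r) = potential c q (l ++ a :: r) + capped c q a := by
  simp only [potential, variation_append_dup, List.map_append, List.map_cons, List.sum_append,
    List.sum_cons]
  ring

theorem potential_replicate (hc : 0 ≤ c) (n : ℕ) : potential c q (List.replicate n q) = 0 := by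
  have h : ∀ n, variation (excess c q) q (List.replicate n q) = 0 := by
    intro n
    induction n with
    | zero => simp [variation, excess_self hc]
    | succ n ih => simp [List.replicate_succ, variation, ih]
  have h0 : capped c q q = 0 := by simp [capped, hc]
  simp [potential, h, h0]

/-- No operation lowers the potential, corrected for the length, by more than it costs. A split or
merge changes the potential by at most `2 * c`, of which the correction compensates one half. -/
theorem potential_sub_length_step_le (hc : 0 ≤ c) {o : Op} {x y : List ℝ} (h : Step o x y) :
    potential c q x - c * x.length ≤ potential c q y - c * y.length + o.cost c := by
  cases h with
  | move l r a w =>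
    have := potential_append_move_le (q := q) hc l r a (a + w)
    simp only [Op.cost, List.length_append, List.length_cons]
    rw [add_sub_cancel_left] at this
    linarith
  | split l r a =>
    have h1 := capped_nonneg (q := q) hc a
    rw [potential_append_dup]
    simp only [Op.cost, List.length_append, List.length_cons]
    push_cast
    linarith
  | merge l r a =>
    have h1 := capped_le (c := c) (q := q) a
    rw [potential_append_dup]
    simp only [Op.cost, List.length_append, List.length_cons]
    push_cast
    linarith

theorem potential_sub_length_le (hc : 0 ≤ c) {S : List Op} {x y : List ℝ}
    (h : Transforms S x y) :
    potential c q x - c * x.length ≤ potential c q y - c * y.length + cost c S := by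
  induction h with
  | nil x => simp [cost]
  | cons h _ ih =>
    have := potential_sub_length_step_le (q := q) hc h
    simp only [cost, List.map_cons, List.sum_cons] at ih ⊢
    linarith

/-- Every transformation to the constant series of the same length costs at least the potential:
splits and merges balance. -/
theorem potential_le_cost (hc : 0 ≤ c) {S : List Op} {x : List ℝ}
    (h : Transforms S x (List.replicate x.length q)) : potential c q x ≤ cost c S := by
  have := potential_sub_length_le (q := q) hc h
  rw [potential_replicate hc, List.length_replicate] at this
  linarith

theorem potential_of_isChain (hc : 0 ≤ c) {y : List ℝ}
    (h : y.IsChain (fun a b => ¬ 0 < excess c q a * excess c q b)) :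
    potential c q y = (y.map fun t => |t - q|).sum := by
  have h' : (q :: y).IsChain (fun a b => ¬ 0 < excess c q a * excess c q b) := by
    cases y with
    | nil => simp
    | cons t r => rw [List.isChain_cons_cons]; exact ⟨by simp [excess_self hc], h⟩
  rw [potential, variation_of_isChain _ _ _ h', excess_self hc]
  have : (fun t => |t - q|) = fun t => capped c q t + |excess c q t| := by
    funext t; rw [capped_add_abs_excess hc]
  rw [this, List.sum_map_add]
  simp

/-- As long as two neighbours lie beyond the threshold on the same side, one of two such neighbours
can be moved to the other and merged with it so that the potential drops by the length of the move
plus `2 * c`. The merge costs only `c`; the other `c` pays for the split that restores the length. -/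
theorem exists_tight_merge (hc : 0 ≤ c) {y : List ℝ}
    (h : ¬ y.IsChain (fun a b => ¬ 0 < excess c q a * excess c q b)) :
    ∃ l u v r, y = l ++ u :: v :: r ∧ 0 < excess c q u * excess c q v ∧
      (potential c q y = potential c q (l ++ v :: r) + |u - v| + 2 * c ∨
       potential c q y = potential c q (l ++ u :: r) + |u - v| + 2 * c) := by
  obtain _ | ⟨b, r⟩ := y
  · simp at h
  have h' : ¬ (q :: b :: r).IsChain (fun a b => ¬ 0 < excess c q a * excess c q b) := by
    rw [List.isChain_cons_cons]; exact fun k => h k.2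
  have hq : ¬ 0 < excess c q q * excess c q b := by simp [excess_self hc]
  rcases exists_tight_merge_aux (excess c q) r q b (fun k => absurd k hq) h' with
    ⟨k, _⟩ | ⟨l, u, v, r', e, huv, k⟩
  · exact absurd k hq
  refine ⟨l, u, v, r', e, huv, ?_⟩
  rw [abs_excess_sub_of_mul_pos hc huv] at k
  have hu := capped_of_excess_ne_zero hc (left_ne_zero_of_mul huv.ne')
  have hv := capped_of_excess_ne_zero hc (right_ne_zero_of_mul huv.ne')
  rw [e] at k ⊢
  simp only [potential, List.map_append, List.map_cons, List.sum_append, List.sum_cons, hu, hv]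
  rcases k with k | k
  · left; rw [k]; ring
  · right; rw [k]; ring

end Potential

/-! ### Recording operations -/

theorem Transforms.append {S T : List Op} {x y z : List ℝ} (h : Transforms S x y)
    (h' : Transforms T y z) : Transforms (S ++ T) x z := by
  induction h with
  | nil => exact h'
  | cons hs _ ih => exact .cons hs (ih h')

theorem Transforms.single {o : Op} {x y : List ℝ} (h : Step o x y) : Transforms [o] x y :=
  .cons h (.nil y)

theorem cost_append (c : ℝ) (S T : List Op) : cost c (S ++ T) = cost c S + cost c T := by
  simp [cost]

theorem Step.move' {x y : List ℝ} {i : ℕ} (l r : List ℝ) (a b w : ℝ) (hx : x = l ++ a :: r)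
    (hy : y = l ++ b :: r) (hi : i = l.length) (hw : a + w = b) : Step (.move i w) x y := by
  subst hx hy hi hw; exact .move l r a w

theorem Step.merge' {x y : List ℝ} {i : ℕ} (l r : List ℝ) (a : ℝ) (hx : x = l ++ a :: a :: r)
    (hy : y = l ++ a :: r) (hi : i = l.length) : Step (.merge i) x y := by
  subst hx hy hi; exact .merge l r a

namespace Graph

variable {G : Graph} {L R : List Node}

theorem record_move {u : Node} {i : ℕ} (w : ℝ) (h : G.sinks = L ++ u :: R) (hi : i = L.length) :
    G.record (.move i w) =
      { nodes := G.nodes ++ [⟨G.nodes.length, u.val + w⟩]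
        edges := G.edges ++ [⟨u, ⟨G.nodes.length, u.val + w⟩, .move⟩]
        sources := G.sources
        sinks := L ++ ⟨G.nodes.length, u.val + w⟩ :: R } := by
  simp [record, h, hi]

theorem record_split {u : Node} {i : ℕ} (h : G.sinks = L ++ u :: R) (hi : i = L.length) :
    G.record (.split i) =
      { nodes := G.nodes ++ [⟨G.nodes.length, u.val⟩, ⟨G.nodes.length + 1, u.val⟩]
        edges := G.edges ++ [⟨u, ⟨G.nodes.length, u.val⟩, .split⟩,
          ⟨u, ⟨G.nodes.length + 1, u.val⟩, .split⟩]
        sources := G.sources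
        sinks := L ++ ⟨G.nodes.length, u.val⟩ :: ⟨G.nodes.length + 1, u.val⟩ :: R } := by
  simp [record, h, hi]

theorem record_merge {u v : Node} {i : ℕ} (h : G.sinks = L ++ u :: v :: R) (hi : i = L.length) :
    G.record (.merge i) =
      { nodes := G.nodes ++ [⟨G.nodes.length, u.val⟩]
        edges := G.edges ++ [⟨u, ⟨G.nodes.length, u.val⟩, .merge⟩,
          ⟨v, ⟨G.nodes.length, u.val⟩, .merge⟩]
        sources := G.sources
        sinks := L ++ ⟨G.nodes.length, u.val⟩ :: R } := by
  simp [record, h, hi]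

theorem undirected_adj {u v : Node} : G.undirected.Adj u v ↔
    u ≠ v ∧ ((∃ k, (⟨u, v, k⟩ : Edge) ∈ G.edges) ∨ ∃ k, (⟨v, u, k⟩ : Edge) ∈ G.edges) := by
  simp [undirected]

theorem undirected_congr {G' : Graph} (h : ∀ e, e ∈ G.edges ↔ e ∈ G'.edges) :
    G.undirected = G'.undirected := by
  ext u v; simp [undirected_adj, h]

theorem undirected_append {G' : Graph} {u v : Node} {k : Kind}
    (h : G'.edges = G.edges ++ [⟨u, v, k⟩]) :
    G'.undirected = G.undirected ⊔ SimpleGraph.edge u v := by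
  ext a b
  simp only [SimpleGraph.sup_adj, SimpleGraph.edge_adj, undirected_adj, h, List.mem_append,
    List.mem_singleton, Edge.mk.injEq]
  constructor
  · rintro ⟨hne, ⟨k', h | h⟩ | ⟨k', h | h⟩⟩
    · exact .inl ⟨hne, .inl ⟨k', h⟩⟩
    · exact .inr ⟨.inl ⟨h.1, h.2.1⟩, hne⟩
    · exact .inl ⟨hne, .inr ⟨k', h⟩⟩
    · exact .inr ⟨.inr ⟨h.2.1, h.1⟩, hne⟩
  · rintro (⟨hne, ⟨k', h⟩ | ⟨k', h⟩⟩ | ⟨⟨h1, h2⟩ | ⟨h1, h2⟩, hne⟩)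
    · exact ⟨hne, .inl ⟨k', .inl h⟩⟩
    · exact ⟨hne, .inr ⟨k', .inl h⟩⟩
    · exact ⟨hne, .inl ⟨k, .inr ⟨h1, h2, rfl⟩⟩⟩
    · exact ⟨hne, .inr ⟨k, .inr ⟨h2, h1, rfl⟩⟩⟩

end Graph

theorem transformationGraph_append (x : List ℝ) (S T : List Op) :
    transformationGraph x (S ++ T) = T.foldl Graph.record (transformationGraph x S) :=
  List.foldl_append

/-! ### Labelled forests -/

theorem eq_of_reachable {V α : Type*} {H : SimpleGraph V} {f : V → α}
    (hf : ∀ a b, H.Adj a b → f a = f b) {a b : V} (h : H.Reachable a b) : f a = f b := by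
  obtain ⟨p⟩ := h
  induction p with
  | nil => rfl
  | cons hadj _ ih => exact (hf _ _ hadj).trans ih

/-- The graph `G` is a forest, and `lab` chooses a representative of each of its weakly connected
components. -/
structure Forest (G : Graph) (lab : Node → Node) : Prop where
  id_lt : ∀ n ∈ G.nodes, n.id < G.nodes.length
  src_mem : ∀ e ∈ G.edges, e.src ∈ G.nodes
  tgt_mem : ∀ e ∈ G.edges, e.tgt ∈ G.nodes
  acyclic : G.undirected.IsAcyclic
  lab_eq : ∀ e ∈ G.edges, lab e.src = lab e.tgt
  reach : ∀ n ∈ G.nodes, G.undirected.Reachable n (lab n)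

namespace Forest

variable {G G' : Graph} {lab : Node → Node}

theorem congr (h : Forest G lab) (hn : G'.nodes = G.nodes)
    (he : ∀ e, e ∈ G'.edges ↔ e ∈ G.edges) : Forest G' lab where
  id_lt := hn ▸ h.id_lt
  src_mem e k := hn ▸ h.src_mem e ((he e).1 k)
  tgt_mem e k := hn ▸ h.tgt_mem e ((he e).1 k)
  acyclic := Graph.undirected_congr he ▸ h.acyclic
  lab_eq e k := h.lab_eq e ((he e).1 k)
  reach := by rw [hn, Graph.undirected_congr he]; exact h.reach

theorem lab_eq_of_adj (h : Forest G lab) (a b : Node) (hab : G.undirected.Adj a b) :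
    lab a = lab b := by
  rcases (Graph.undirected_adj.1 hab).2 with ⟨k, hk⟩ | ⟨k, hk⟩
  · exact h.lab_eq _ hk
  · exact (h.lab_eq _ hk).symm

theorem mem_nodes_of_adj (h : Forest G lab) (a b : Node) (hab : G.undirected.Adj a b) :
    a ∈ G.nodes := by
  rcases (Graph.undirected_adj.1 hab).2 with ⟨k, hk⟩ | ⟨k, hk⟩
  · exact h.src_mem _ hk
  · exact h.tgt_mem _ hk

theorem mem_component_iff (h : Forest G lab) {u v : Node} (hu : u ∈ G.nodes) (hv : v ∈ G.nodes) :
    v ∈ (G.component u).supp ↔ lab v = lab u := by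
  rw [SimpleGraph.ConnectedComponent.mem_supp_iff, SimpleGraph.ConnectedComponent.eq]
  refine ⟨eq_of_reachable h.lab_eq_of_adj, fun e => (h.reach v hv).trans ?_⟩
  rw [e]
  exact (h.reach u hu).symm

theorem isTree (h : Forest G lab) (C : G.undirected.ConnectedComponent) :
    C.toSimpleGraph.IsTree := h.acyclic.isTree_connectedComponent C

/-- A new edge to a new node preserves a forest. -/
theorem addLeaf (h : Forest G lab) {u v : Node} {k : Kind} (hu : u ∈ G.nodes)
    (hv : v.id = G.nodes.length) (hn : G'.nodes = G.nodes ++ [v])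
    (he : G'.edges = G.edges ++ [⟨u, v, k⟩]) :
    ∃ lab', Forest G' lab' ∧ lab' v = lab u ∧ ∀ n ∈ G.nodes, lab' n = lab n := by
  have hold : ∀ n ∈ G.nodes, n.id ≠ G.nodes.length := fun n k => (h.id_lt n k).ne
  have hund := Graph.undirected_append he
  have huv : u ≠ v := fun e => hold u hu (e ▸ hv)
  refine ⟨fun n => if n.id = G.nodes.length then lab u else lab n, ⟨?_, ?_, ?_, ?_, ?_, ?_⟩,
    by simp [hv], fun n hn => by simp [hold n hn]⟩
  · intro n hn'
    rw [hn] at hn' ⊢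
    rcases List.mem_append.1 hn' with k | k
    · have := h.id_lt n k
      simp; omega
    · rw [List.mem_singleton.1 k, hv]; simp
  · intro e k
    rw [he] at k; rw [hn]
    rcases List.mem_append.1 k with k | k
    · exact List.mem_append_left _ (h.src_mem e k)
    · rw [List.mem_singleton.1 k]; exact List.mem_append_left _ hu
  · intro e k
    rw [he] at k; rw [hn]
    rcases List.mem_append.1 k with k | k
    · exact List.mem_append_left _ (h.tgt_mem e k)
    · rw [List.mem_singleton.1 k]; simp
  · rw [hund]
    refine SimpleGraph.IsAcyclic.sup_edge_of_not_reachable (fun hr => ?_) h.acyclic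
    -- no edge of `G` meets the new node
    have := eq_of_reachable (f := fun n => n = v) (fun a b hab => ?_) hr
    · exact huv (by simpa using this)
    · have ha := hold _ (h.mem_nodes_of_adj a b hab)
      have hb := hold _ (h.mem_nodes_of_adj b a hab.symm)
      rw [← hv] at ha hb
      have ha' : a ≠ v := fun e => ha (by rw [e])
      have hb' : b ≠ v := fun e => hb (by rw [e])
      simp [ha', hb']
  · intro e k
    rw [he] at k
    rcases List.mem_append.1 k with k | k
    · simp [hold _ (h.src_mem e k), hold _ (h.tgt_mem e k), h.lab_eq e k]
    · rw [List.mem_singleton.1 k]; simp [hv]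
  · intro n hn'
    rw [hn] at hn'
    have hle : G.undirected ≤ G'.undirected := hund ▸ le_sup_left
    rcases List.mem_append.1 hn' with k | k
    · simpa [hold n k] using (h.reach n k).mono hle
    · have hadj : G'.undirected.Adj v u := by
        rw [hund, SimpleGraph.sup_adj, SimpleGraph.edge_adj]
        exact .inr ⟨.inr ⟨rfl, rfl⟩, huv.symm⟩
      rw [List.mem_singleton.1 k]
      simpa [hv] using hadj.reachable.trans ((h.reach u hu).mono hle)

open Classical in
/-- A new edge between two components joins them; its target represents the joint component. -/
theorem join (h : Forest G lab) {b m : Node} {k : Kind} (hb : b ∈ G.nodes) (hm : m ∈ G.nodes)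
    (hbm : lab b ≠ lab m) (hn : G'.nodes = G.nodes) (he : G'.edges = G.edges ++ [⟨b, m, k⟩]) :
    Forest G' (fun n => if lab n = lab b ∨ lab n = lab m then m else lab n) := by
  have hund := Graph.undirected_append he
  have hle : G.undirected ≤ G'.undirected := hund ▸ le_sup_left
  refine ⟨hn ▸ h.id_lt, ?_, ?_, ?_, ?_, ?_⟩
  · intro e k
    rw [he] at k; rw [hn]
    rcases List.mem_append.1 k with k | k
    · exact h.src_mem e k
    · rw [List.mem_singleton.1 k]; exact hb
  · intro e k
    rw [he] at k; rw [hn]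
    rcases List.mem_append.1 k with k | k
    · exact h.tgt_mem e k
    · rw [List.mem_singleton.1 k]; exact hm
  · rw [hund]
    exact SimpleGraph.IsAcyclic.sup_edge_of_not_reachable
      (fun hr => hbm (eq_of_reachable h.lab_eq_of_adj hr)) h.acyclic
  · intro e k
    rw [he] at k
    rcases List.mem_append.1 k with k | k
    · simp [h.lab_eq e k]
    · rw [List.mem_singleton.1 k]; simp
  · intro n hn'
    rw [hn] at hn'
    have hr := h.reach n hn'
    have hadj : G'.undirected.Adj b m := by
      rw [hund, SimpleGraph.sup_adj, SimpleGraph.edge_adj]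
      exact .inr ⟨.inl ⟨rfl, rfl⟩, fun e => hbm (e ▸ rfl)⟩
    split_ifs with hc
    · rcases hc with hc | hc
      · rw [hc] at hr
        exact ((hr.trans (h.reach b hb).symm).mono hle).trans hadj.reachable
      · rw [hc] at hr
        exact (hr.trans (h.reach m hm).symm).mono hle
    · exact hr.mono hle

end Forest

/-! ### Gathering neighbours on the same side -/

/-- The state while points are being gathered by moves and merges: a forest in which each component
has exactly one sink, `root n` being the sink of the component of `n`. A source that is still a sink
forms a component of its own; any other sink was produced by a merge and has gathered at least two
sources, all of them beyond the threshold and on its side of `q`. -/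
structure Gathered (c q : ℝ) (G : Graph) (root : Node → Node) : Prop extends Forest G root where
  sources_mem : ∀ n ∈ G.sources, n ∈ G.nodes
  sinks_mem : ∀ n ∈ G.sinks, n ∈ G.nodes
  nodup_sources : G.sources.Nodup
  nodup_sinks : G.sinks.Nodup
  root_mem : ∀ n ∈ G.nodes, root n ∈ G.sinks
  root_sink : ∀ s ∈ G.sinks, root s = s
  src_notMem_sinks : ∀ e ∈ G.edges, e.src ∉ G.sinks
  kind : ∀ e ∈ G.edges, e.kind = .merge ∨ e.kind = .move
  kind_of_sink : ∀ e ∈ G.edges, e.tgt ∈ G.sinks → e.kind = .merge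
  isolated : ∀ n ∈ G.nodes, root n ∈ G.sources → n = root n
  two_sources : ∀ s ∈ G.sinks, s ∉ G.sources →
    ∃ a ∈ G.sources, ∃ b ∈ G.sources, a ≠ b ∧ root a = s ∧ root b = s
  side : ∀ a ∈ G.sources, a = root a ∨ 0 < excess c q a.val * excess c q (root a).val

theorem excess_mul_pos_trans {c q a b d : ℝ} (h : 0 < excess c q a * excess c q b)
    (h' : 0 < excess c q b * excess c q d) : 0 < excess c q a * excess c q d := by
  rw [mul_pos_iff] at *
  grind

theorem Gathered.exists_source {c q : ℝ} {G : Graph} {root : Node → Node}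
    (h : Gathered c q G root) {s : Node} (hs : s ∈ G.sinks) : ∃ a ∈ G.sources, root a = s := by
  by_cases hss : s ∈ G.sources
  · exact ⟨s, hss, h.root_sink s hs⟩
  · obtain ⟨a, ha, -, -, -, e, -⟩ := h.two_sources s hs hss
    exact ⟨a, ha, e⟩

theorem gathered_init (c q : ℝ) (x : List ℝ) : Gathered c q (Graph.init x) id where
  id_lt n hn := by
    obtain ⟨i, hi, rfl⟩ := List.mem_mapIdx.1 hn
    simpa [Graph.init] using hi
  src_mem e he := by simp [Graph.init] at he
  tgt_mem e he := by simp [Graph.init] at he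
  acyclic := by
    have : (Graph.init x).undirected = ⊥ := by
      ext u v; simp [Graph.undirected_adj, Graph.init]
    rw [this]; exact SimpleGraph.isAcyclic_bot
  lab_eq e he := by simp [Graph.init] at he
  reach n _ := SimpleGraph.Reachable.refl n
  sources_mem n hn := hn
  sinks_mem n hn := hn
  nodup_sources := by
    rw [List.nodup_iff_injective_getElem]
    intro i j h
    have := congrArg Node.id h
    simp [Graph.init] at this
    exact Fin.ext this
  nodup_sinks := by
    rw [List.nodup_iff_injective_getElem]
    intro i j h
    have := congrArg Node.id h
    simp [Graph.init] at this
    exact Fin.ext this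
  root_mem n hn := hn
  root_sink s _ := rfl
  src_notMem_sinks e he := by simp [Graph.init] at he
  kind e he := by simp [Graph.init] at he
  kind_of_sink e he := by simp [Graph.init] at he
  isolated n _ _ := rfl
  two_sources s hs hs' := absurd hs hs'
  side a _ := .inl rfl

open Classical in
/-- Moving the sink `a` and merging it with its neighbour `b` preserves the gathering state; `m₁` is
the moved and `m₂` the merged point. -/
theorem Gathered.step {c q : ℝ} {G G' : Graph} {root : Node → Node} (h : Gathered c q G root)
    {L R : List Node} {u v a b m₁ m₂ : Node} (hs : G.sinks = L ++ u :: v :: R)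
    (hab : (a = u ∧ b = v) ∨ (a = v ∧ b = u)) (hpos : 0 < excess c q a.val * excess c q b.val)
    (hid₁ : m₁.id = G.nodes.length) (hid₂ : m₂.id = G.nodes.length + 1) (hval : m₂.val = b.val)
    (hnodes : G'.nodes = G.nodes ++ [m₁, m₂]) (hsources : G'.sources = G.sources)
    (hsinks : G'.sinks = L ++ m₂ :: R)
    (hedges : ∀ e, e ∈ G'.edges ↔ e ∈ G.edges ++ [⟨a, m₁, .move⟩, ⟨m₁, m₂, .merge⟩,
      ⟨b, m₂, .merge⟩]) :
    ∃ root', Gathered c q G' root' := by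
  have hnd := h.nodup_sinks
  rw [hs] at hnd
  have hamem : a ∈ G.sinks := by rw [hs]; grind
  have hbmem : b ∈ G.sinks := by rw [hs]; grind
  have hne : a ≠ b := by grind
  have haL : a ∉ L ∧ a ∉ R := by grind
  have hbL : b ∉ L ∧ b ∉ R := by grind
  have hsub : ∀ n, n ∈ G'.sinks ↔ n = m₂ ∨ (n ∈ G.sinks ∧ n ≠ a ∧ n ≠ b) := by
    intro n; rw [hsinks, hs]; grind
  have ha := h.sinks_mem a hamem
  have hb := h.sinks_mem b hbmem
  have hold₁ : m₁ ∉ G.nodes := fun k => (h.id_lt _ k).ne hid₁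
  have hold₂ : m₂ ∉ G.nodes := fun k => absurd (h.id_lt _ k) (by omega)
  have hm : m₁ ≠ m₂ := fun k => by rw [k] at hid₁; omega
  -- the forest grows by two leaves, the second of which is then joined to `b`
  obtain ⟨lab₁, f₁, e₁, o₁⟩ := h.toForest.addLeaf (k := .move)
    (G' := ⟨G.nodes ++ [m₁], G.edges ++ [⟨a, m₁, .move⟩], [], []⟩) ha hid₁ rfl rfl
  obtain ⟨lab₂, f₂, e₂, o₂⟩ := f₁.addLeaf (u := m₁) (v := m₂) (k := .merge)
    (G' := ⟨G.nodes ++ [m₁] ++ [m₂], G.edges ++ [⟨a, m₁, .move⟩] ++ [⟨m₁, m₂, .merge⟩], [], []⟩)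
    (by simp) (by simp [hid₂]) rfl rfl
  have r₁ : lab₂ m₁ = a := by
    rw [o₂ m₁ (by simp), e₁, h.root_sink a hamem]
  have r₂ : lab₂ m₂ = a := by rw [e₂, e₁, h.root_sink a hamem]
  have ro : ∀ n ∈ G.nodes, lab₂ n = root n := fun n hn => by
    rw [o₂ n (by simp [hn]), o₁ n hn]
  have rb : lab₂ b = b := by rw [ro b hb, h.root_sink b hbmem]
  have f₃ := f₂.join (b := b) (m := m₂) (k := .merge)
    (G' := ⟨G.nodes ++ [m₁] ++ [m₂], G.edges ++ [⟨a, m₁, .move⟩] ++ [⟨m₁, m₂, .merge⟩] ++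
      [⟨b, m₂, .merge⟩], [], []⟩) (by simp [hb]) (by simp) (by rw [rb, r₂]; exact hne.symm) rfl rfl
  rw [rb, r₂] at f₃
  have f₄ : Forest G' _ := f₃.congr (by simp [hnodes]) (fun e => by rw [hedges]; simp)
  set root' : Node → Node := fun n => if lab₂ n = b ∨ lab₂ n = a then m₂ else lab₂ n with hroot'
  have n₁ : root' m₁ = m₂ := by simp [hroot', r₁]
  have n₂ : root' m₂ = m₂ := by simp [hroot', r₂]
  have no : ∀ n ∈ G.nodes, (root n = a ∨ root n = b) ∧ root' n = m₂ ∨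
      (root n ≠ a ∧ root n ≠ b) ∧ root' n = root n := by
    intro n hn
    simp only [hroot', ro n hn]
    grind
  have hm₂s : m₂ ∉ G.sources := fun k => hold₂ (h.sources_mem _ k)
  refine ⟨root', ⟨f₄, ?_, ?_, ?_, ?_, ?_, ?_, ?_, ?_, ?_, ?_, ?_, ?_⟩⟩
  · intro n hn
    rw [hsources] at hn; rw [hnodes]
    exact List.mem_append_left _ (h.sources_mem n hn)
  · intro n hn
    rw [hnodes]
    rcases (hsub n).1 hn with rfl | ⟨k, -⟩
    · simp
    · exact List.mem_append_left _ (h.sinks_mem n k)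
  · rw [hsources]; exact h.nodup_sources
  · have hL : m₂ ∉ L := fun k => hold₂ (h.sinks_mem _ (by rw [hs]; simp [k]))
    have hR : m₂ ∉ R := fun k => hold₂ (h.sinks_mem _ (by rw [hs]; simp [k]))
    rw [hsinks]; grind
  · intro n hn
    rw [hsub]
    rw [hnodes] at hn
    rcases List.mem_append.1 hn with k | k
    · rcases no n k with ⟨-, e⟩ | ⟨k', e⟩
      · exact .inl e
      · exact .inr (e ▸ ⟨h.root_mem n k, k'⟩)
    · left; grind
  · intro s hs'
    rcases (hsub s).1 hs' with rfl | ⟨k, k₁, k₂⟩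
    · exact n₂
    · have := h.root_sink s k
      rcases no s (h.sinks_mem s k) with ⟨k', -⟩ | ⟨-, e⟩
      · rw [this] at k'; exact absurd k' (by simp [k₁, k₂])
      · rw [e, this]
  · intro e he hes
    rcases (hsub _).1 hes with k | ⟨k, k₁, k₂⟩ <;>
    rcases List.mem_append.1 ((hedges e).1 he) with k' | k'
    · exact hold₂ (k ▸ h.src_mem e k')
    · simp only [List.mem_cons, List.not_mem_nil, or_false] at k'
      rcases k' with rfl | rfl | rfl
      · exact hold₂ (k ▸ ha)
      · exact hm k
      · exact hold₂ (k ▸ hb)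
    · exact h.src_notMem_sinks e k' k
    · simp only [List.mem_cons, List.not_mem_nil, or_false] at k'
      rcases k' with rfl | rfl | rfl
      · exact k₁ rfl
      · exact hold₁ (h.sinks_mem _ k)
      · exact k₂ rfl
  · intro e he
    rcases List.mem_append.1 ((hedges e).1 he) with k' | k'
    · exact h.kind e k'
    · simp only [List.mem_cons, List.not_mem_nil, or_false] at k'
      rcases k' with rfl | rfl | rfl <;> simp
  · intro e he hes
    rcases List.mem_append.1 ((hedges e).1 he) with k' | k'
    · rcases (hsub _).1 hes with k | ⟨k, -, -⟩
      · exact absurd (h.tgt_mem e k') (k ▸ hold₂)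
      · exact h.kind_of_sink e k' k
    · simp only [List.mem_cons, List.not_mem_nil, or_false] at k'
      rcases k' with rfl | rfl | rfl
      · rcases (hsub _).1 hes with k | ⟨k, -, -⟩
        · exact absurd k hm
        · exact absurd (h.sinks_mem _ k) hold₁
      · rfl
      · rfl
  · intro n hn hr
    rw [hsources] at hr
    rw [hnodes] at hn
    rcases List.mem_append.1 hn with k | k
    · rcases no n k with ⟨-, e⟩ | ⟨-, e⟩
      · rw [e] at hr; exact absurd hr hm₂s
      · rw [e] at hr ⊢; exact h.isolated n k hr
    · simp only [List.mem_cons, List.not_mem_nil, or_false] at k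
      rcases k with rfl | rfl
      · rw [n₁] at hr; exact absurd hr hm₂s
      · rw [n₂] at hr; exact absurd hr hm₂s
  · intro s hs' hss
    rw [hsources] at hss ⊢
    rcases (hsub s).1 hs' with rfl | ⟨k, k₁, k₂⟩
    · obtain ⟨a', ha', ea⟩ := h.exists_source hamem
      obtain ⟨b', hb', eb⟩ := h.exists_source hbmem
      refine ⟨a', ha', b', hb', fun e => hne (by rw [← ea, ← eb, e]), ?_, ?_⟩
      · rcases no a' (h.sources_mem _ ha') with k | k
        · exact k.2
        · exact absurd ea k.1.1
      · rcases no b' (h.sources_mem _ hb') with k | k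
        · exact k.2
        · exact absurd eb k.1.2
    · obtain ⟨a', ha', b', hb', hne', ea, eb⟩ := h.two_sources s k hss
      refine ⟨a', ha', b', hb', hne', ?_, ?_⟩
      · rcases no a' (h.sources_mem _ ha') with k | k
        · rw [ea] at k; exact absurd k.1 (by simp [k₁, k₂])
        · rw [k.2, ea]
      · rcases no b' (h.sources_mem _ hb') with k | k
        · rw [eb] at k; exact absurd k.1 (by simp [k₁, k₂])
        · rw [k.2, eb]
  · intro n hn
    rw [hsources] at hn
    have hbb := excess_mul_pos_trans (by rwa [mul_comm] at hpos) hpos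
    rcases no n (h.sources_mem n hn) with ⟨k, e⟩ | ⟨-, e⟩
    · right
      rw [e, hval]
      rcases h.side n hn with k' | k' <;> rcases k with k | k <;> rw [k] at k'
      · rw [k']; exact hpos
      · rw [k']; exact hbb
      · exact excess_mul_pos_trans k' hpos
      · exact k'
    · rw [e]; exact h.side n hn

/-- The sinks of `transformationGraph x S` carry the series reached by `S`, whose cost is the loss
of potential, corrected for the lost length; the gathering state has been preserved. -/
structure GathersTo (c q : ℝ) (x : List ℝ) (S : List Op) (root : Node → Node) : Prop where
  gathered : Gathered c q (transformationGraph x S) root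
  sources_length : (transformationGraph x S).sources.length = x.length
  transforms : Transforms S x ((transformationGraph x S).sinks.map Node.val)
  cost_eq : cost c S + c * (x.length - (transformationGraph x S).sinks.length) +
    potential c q ((transformationGraph x S).sinks.map Node.val) = potential c q x

theorem sinks_map_val_init (x : List ℝ) : (transformationGraph x []).sinks.map Node.val = x :=
  List.ext_getElem (by simp [transformationGraph, Graph.init])
    (by simp [transformationGraph, Graph.init])

theorem gathersTo_nil (c q : ℝ) (x : List ℝ) : GathersTo c q x [] id where
  gathered := gathered_init c q x
  sources_length := by simp [transformationGraph, Graph.init]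
  transforms := by
    rw [sinks_map_val_init]; exact .nil x
  cost_eq := by
    rw [sinks_map_val_init]; simp [cost, transformationGraph, Graph.init]

theorem GathersTo.exists_step {c q : ℝ} (hc : 0 ≤ c) {x : List ℝ} {S : List Op}
    {root : Node → Node} (h : GathersTo c q x S root)
    (hchain : ¬ ((transformationGraph x S).sinks.map Node.val).IsChain
      (fun a b => ¬ 0 < excess c q a * excess c q b)) :
    ∃ S' root', GathersTo c q x S' root' ∧
      (transformationGraph x S').sinks.length < (transformationGraph x S).sinks.length := by
  obtain ⟨l, a, b, r, hy, hpos, hpot⟩ := exists_tight_merge hc hchain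
  have hcost := h.cost_eq
  have htr := h.transforms
  have hsl := h.sources_length
  set G := transformationGraph x S with hG
  obtain ⟨L, K, hs, rfl, hK⟩ := List.map_eq_append_iff.1 hy
  obtain ⟨u, K', rfl, rfl, hK'⟩ := List.map_eq_cons_iff.1 hK
  obtain ⟨v, R, rfl, rfl, rfl⟩ := List.map_eq_cons_iff.1 hK'
  rw [hy] at htr
  rcases hpot with hpot | hpot
  · -- `u` is moved to `v`
    let w := v.val - u.val
    have e₁ := Graph.record_move (G := G) w hs rfl
    have e₂ := Graph.record_merge (G := G.record (.move L.length w)) (i := L.length)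
      (L := L) (R := R) (u := ⟨G.nodes.length, u.val + w⟩) (v := v) (by rw [e₁]) rfl
    have hw : u.val + w = v.val := by simp [w]
    rw [hw] at e₁ e₂
    rw [e₁] at e₂
    have hT : transformationGraph x (S ++ [.move L.length w, .merge L.length]) =
        (G.record (.move L.length w)).record (.merge L.length) := by
      rw [transformationGraph_append]; rfl
    rw [e₁, e₂] at hT
    obtain ⟨root', hr⟩ := h.gathered.step (a := u) (b := v) (G' := transformationGraph x _)
      (m₁ := ⟨G.nodes.length, v.val⟩) (m₂ := ⟨G.nodes.length + 1, v.val⟩)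
      hs (.inl ⟨rfl, rfl⟩) hpos rfl rfl rfl (by rw [hT]; simp [hG]) (by rw [hT]) (by rw [hT]; simp)
      (fun e => by rw [hT]; simp; tauto)
    refine ⟨_, root', ⟨hr, ?_, ?_, ?_⟩, ?_⟩
    · rw [hT]; exact hsl
    · rw [hT]
      refine htr.append (.cons (.move' (L.map Node.val) (v.val :: R.map Node.val) u.val v.val w rfl
        rfl (by simp) hw) (.single (.merge' (L.map Node.val) (R.map Node.val) v.val rfl
        (by simp) (by simp))))
    · have : |w| = |u.val - v.val| := abs_sub_comm _ _
      rw [hT, cost_append]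
      rw [hs] at hcost hpot
      simp [cost, Op.cost] at hcost hpot ⊢
      rw [this]; linarith
    · rw [hT, hs]; simp
  · -- `v` is moved to `u`
    let w := u.val - v.val
    have e₁ := Graph.record_move (G := G) (L := L ++ [u]) (R := R) (u := v)
      (i := L.length + 1) w (by simp [hs]) (by simp)
    have e₂ := Graph.record_merge (G := G.record (.move (L.length + 1) w)) (i := L.length)
      (L := L) (R := R) (u := u) (v := ⟨G.nodes.length, v.val + w⟩) (by rw [e₁]; simp) rfl
    have hw : v.val + w = u.val := by simp [w]
    rw [hw] at e₁ e₂
    rw [e₁] at e₂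
    have hT : transformationGraph x (S ++ [.move (L.length + 1) w, .merge L.length]) =
        (G.record (.move (L.length + 1) w)).record (.merge L.length) := by
      rw [transformationGraph_append]; rfl
    rw [e₁, e₂] at hT
    obtain ⟨root', hr⟩ := h.gathered.step (a := v) (b := u) (G' := transformationGraph x _)
      (m₁ := ⟨G.nodes.length, u.val⟩) (m₂ := ⟨G.nodes.length + 1, u.val⟩)
      hs (.inr ⟨rfl, rfl⟩) (by rwa [mul_comm]) rfl rfl rfl (by rw [hT]; simp [hG]) (by rw [hT])
      (by rw [hT]; simp) (fun e => by rw [hT]; simp; tauto)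
    refine ⟨_, root', ⟨hr, ?_, ?_, ?_⟩, ?_⟩
    · rw [hT]; exact hsl
    · rw [hT]
      refine htr.append (.cons (.move' ((L ++ [u]).map Node.val) (R.map Node.val) v.val u.val w
        (by simp) rfl (by simp) hw) (.single (.merge' (L.map Node.val) (R.map Node.val) u.val
        (by simp) (by simp) (by simp))))
    · have : |w| = |u.val - v.val| := rfl
      rw [hT, cost_append]
      rw [hs] at hcost hpot
      simp [cost, Op.cost] at hcost hpot ⊢
      rw [this]; linarith
    · rw [hT, hs]; simp

theorem exists_gathersTo {c : ℝ} (hc : 0 ≤ c) (q : ℝ) (x : List ℝ) :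
    ∃ S root, GathersTo c q x S root ∧ ((transformationGraph x S).sinks.map Node.val).IsChain
      (fun a b => ¬ 0 < excess c q a * excess c q b) := by
  have key : ∀ n S root, GathersTo c q x S root → (transformationGraph x S).sinks.length = n →
      ∃ S root, GathersTo c q x S root ∧ ((transformationGraph x S).sinks.map Node.val).IsChain
        (fun a b => ¬ 0 < excess c q a * excess c q b) := by
    intro n
    induction n using Nat.strong_induction_on with
    | _ n ih =>
      intro S root h hn
      by_cases hch : ((transformationGraph x S).sinks.map Node.val).IsChain
        (fun a b => ¬ 0 < excess c q a * excess c q b)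
      · exact ⟨S, root, h, hch⟩
      · obtain ⟨S', root', h', hlt⟩ := h.exists_step hc hch
        exact ih _ (hn ▸ hlt) S' root' h' rfl
  exact key _ [] id (gathersTo_nil c q x) rfl

/-! ### Stages of a component -/

/-- The stages that the points of a Type-4-Tree pass through: `gathering` before the last merge,
`merged` after it, `levelled` once the merged point has been moved to its final value, and `spread`
after a split. -/
inductive Stage where
  | gathering
  | merged
  | levelled
  | spread

/-- `StageStep s k t`: an edge of kind `k` may lead from a point in stage `s` to one in stage
`t`. -/
inductive StageStep : Stage → Kind → Stage → Prop where
  | move : StageStep .gathering .move .gathering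
  | merge : StageStep .gathering .merge .gathering
  | lastMerge : StageStep .gathering .merge .merged
  | level : StageStep .merged .move .levelled
  | firstSplit : StageStep .levelled .split .spread
  | split : StageStep .spread .split .spread

/-- A forest whose edges respect the stages of their ends. -/
structure StagedForest (G : Graph) (lab : Node → Node) (st : Node → Stage) : Prop
    extends Forest G lab where
  stage_step : ∀ e ∈ G.edges, StageStep (st e.src) e.kind (st e.tgt)

/-- The stage of the first point determines which part of the pattern of a Type 4 path is still to
come. -/
theorem StagedForest.path_kinds {G : Graph} {lab : Node → Node} {st : Node → Stage}
    (h : StagedForest G lab st) {u v : Node} {ks : List Kind} (p : G.Path u v ks)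
    (hv : st v = .spread) :
    (st u = .spread → ∀ k ∈ ks, k = .split) ∧
    (st u = .levelled → ∃ bs, ks = .split :: bs ∧ ∀ k ∈ bs, k = .split) ∧
    (st u = .merged → ∃ bs, ks = .move :: .split :: bs ∧ ∀ k ∈ bs, k = .split) ∧
    (st u = .gathering → ∃ as bs, ks = as ++ [.merge, .move, .split] ++ bs ∧
      (∀ k ∈ as, k = .merge ∨ k = .move) ∧ ∀ k ∈ bs, k = .split) := by
  induction p with
  | nil u => simp [hv]
  | @cons u v w k ks he p ih =>
    obtain ⟨i₁, i₂, i₃, i₄⟩ := ih hv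
    have hstep := h.stage_step _ he
    dsimp only at hstep
    generalize st u = a at hstep ⊢
    generalize st v = b at hstep i₁ i₂ i₃ i₄
    cases hstep with
    | move =>
      obtain ⟨as, bs, rfl, ha, hb⟩ := i₄ rfl
      simp only [reduceCtorEq, false_implies, true_and, true_implies]
      exact ⟨.move :: as, bs, rfl, by simpa using ha, hb⟩
    | merge =>
      obtain ⟨as, bs, rfl, ha, hb⟩ := i₄ rfl
      simp only [reduceCtorEq, false_implies, true_and, true_implies]
      exact ⟨.merge :: as, bs, rfl, by simpa using ha, hb⟩
    | lastMerge =>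
      obtain ⟨bs, rfl, hb⟩ := i₃ rfl
      simp only [reduceCtorEq, false_implies, true_and, true_implies]
      exact ⟨[], bs, rfl, by simp, hb⟩
    | level =>
      obtain ⟨bs, rfl, hb⟩ := i₂ rfl
      simp only [reduceCtorEq, false_implies, true_and, and_true, true_implies]
      exact ⟨bs, rfl, hb⟩
    | firstSplit =>
      simp only [reduceCtorEq, false_implies, true_and, and_true, true_implies]
      exact ⟨ks, rfl, i₁ rfl⟩
    | split =>
      simp only [reduceCtorEq, false_implies, and_true, true_implies]
      simpa using i₁ rfl

/-- `G'` is obtained from `G` by adding nodes and edges to the component represented by `s`. -/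
structure Extension (s : Node) (G : Graph) (lab : Node → Node) (st : Node → Stage)
    (G' : Graph) (lab' : Node → Node) (st' : Node → Stage) : Prop where
  sources_eq : G'.sources = G.sources
  nodes_sub : ∀ n ∈ G.nodes, n ∈ G'.nodes
  lab_old : ∀ n ∈ G.nodes, lab' n = lab n
  stage_old : ∀ n ∈ G.nodes, st' n = st n
  lab_new : ∀ n ∈ G'.nodes, n ∈ G.nodes ∨ lab' n = s
  edges_sub : ∀ e ∈ G.edges, e ∈ G'.edges
  edges_new : ∀ e ∈ G'.edges, e ∈ G.edges ∨ lab' e.src = s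

theorem Extension.refl (s : Node) (G : Graph) (lab : Node → Node) (st : Node → Stage) :
    Extension s G lab st G lab st where
  sources_eq := rfl
  nodes_sub _ h := h
  lab_old _ _ := rfl
  stage_old _ _ := rfl
  lab_new _ h := .inl h
  edges_sub _ h := h
  edges_new _ h := .inl h

theorem Extension.trans {s : Node} {G₁ G₂ G₃ : Graph} {l₁ l₂ l₃ : Node → Node}
    {s₁ s₂ s₃ : Node → Stage} (h : Extension s G₁ l₁ s₁ G₂ l₂ s₂)
    (h' : Extension s G₂ l₂ s₂ G₃ l₃ s₃) (hs : ∀ e ∈ G₂.edges, e.src ∈ G₂.nodes) :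
    Extension s G₁ l₁ s₁ G₃ l₃ s₃ where
  sources_eq := h'.sources_eq.trans h.sources_eq
  nodes_sub n k := h'.nodes_sub n (h.nodes_sub n k)
  lab_old n k := (h'.lab_old n (h.nodes_sub n k)).trans (h.lab_old n k)
  stage_old n k := (h'.stage_old n (h.nodes_sub n k)).trans (h.stage_old n k)
  lab_new n k := by
    rcases h'.lab_new n k with k' | k'
    · rcases h.lab_new n k' with k'' | k''
      · exact .inl k''
      · exact .inr ((h'.lab_old n k').trans k'')
    · exact .inr k'
  edges_sub e k := h'.edges_sub e (h.edges_sub e k)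
  edges_new e k := by
    rcases h'.edges_new e k with k' | k'
    · rcases h.edges_new e k' with k'' | k''
      · exact .inl k''
      · exact .inr ((h'.lab_old _ (hs e k')).trans k'')
    · exact .inr k'

theorem StagedForest.addLeaf {G G' : Graph} {lab : Node → Node} {st : Node → Stage}
    (h : StagedForest G lab st) {u v : Node} {k : Kind} {t : Stage} (hu : u ∈ G.nodes)
    (hv : v.id = G.nodes.length) (ht : StageStep (st u) k t) (hn : G'.nodes = G.nodes ++ [v])
    (he : G'.edges = G.edges ++ [⟨u, v, k⟩]) (hs : G'.sources = G.sources) :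
    ∃ lab' st', StagedForest G' lab' st' ∧ Extension (lab u) G lab st G' lab' st' ∧
      lab' v = lab u ∧ st' v = t := by
  obtain ⟨lab', f, e, o⟩ := h.toForest.addLeaf hu hv hn he
  have hold : ∀ n ∈ G.nodes, n.id ≠ G.nodes.length := fun n k => (h.id_lt n k).ne
  refine ⟨lab', fun n => if n.id = G.nodes.length then t else st n, ⟨f, ?_⟩,
    ⟨hs, ?_, o, ?_, ?_, ?_, ?_⟩, e, by simp [hv]⟩
  · intro e k
    rw [he] at k
    rcases List.mem_append.1 k with k | k
    · simpa [hold _ (h.src_mem e k), hold _ (h.tgt_mem e k)] using h.stage_step e k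
    · rw [List.mem_singleton.1 k]; simpa [hold u hu, hv] using ht
  · intro n k; rw [hn]; exact List.mem_append_left _ k
  · intro n k; simp [hold n k]
  · intro n k
    rw [hn] at k
    rcases List.mem_append.1 k with k | k
    · exact .inl k
    · rw [List.mem_singleton.1 k]; exact .inr e
  · intro e k; rw [he]; exact List.mem_append_left _ k
  · intro e k
    rw [he] at k
    rcases List.mem_append.1 k with k | k
    · exact .inl k
    · rw [List.mem_singleton.1 k]; exact .inr (o u hu)

/-- A split adds two leaves in the last stage. -/
theorem StagedForest.split {G : Graph} {lab : Node → Node} {st : Node → Stage}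
    (h : StagedForest G lab st) {L R : List Node} {p : Node} (hs : G.sinks = L ++ p :: R)
    (hp : p ∈ G.nodes) (hst : st p = .levelled ∨ st p = .spread) :
    ∃ v₁ v₂ lab' st', StagedForest (G.record (.split L.length)) lab' st' ∧
      Extension (lab p) G lab st (G.record (.split L.length)) lab' st' ∧
      (G.record (.split L.length)).sinks = L ++ v₁ :: v₂ :: R ∧ v₁ ≠ v₂ ∧
      ∀ v, v = v₁ ∨ v = v₂ → v ∉ G.nodes ∧ v ∈ (G.record (.split L.length)).nodes ∧
        v.val = p.val ∧ lab' v = lab p ∧ st' v = .spread := by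
  have hstep : StageStep (st p) .split .spread := by
    rcases hst with e | e <;> rw [e]
    · exact .firstSplit
    · exact .split
  rw [Graph.record_split hs rfl]
  set v₁ : Node := ⟨G.nodes.length, p.val⟩
  set v₂ : Node := ⟨G.nodes.length + 1, p.val⟩
  have hf₁ : v₁ ∉ G.nodes := fun k => (h.id_lt _ k).ne rfl
  have hf₂ : v₂ ∉ G.nodes := fun k => absurd (h.id_lt _ k) (by simp [v₂])
  have hne : v₁ ≠ v₂ := fun k => by simp [v₁, v₂] at k
  obtain ⟨l₁, s₁, f₁, x₁, e₁, t₁⟩ := h.addLeaf (v := v₁)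
    (G' := ⟨G.nodes ++ [v₁], G.edges ++ [⟨p, v₁, .split⟩], G.sources, []⟩)
    hp rfl hstep rfl rfl rfl
  obtain ⟨l₂, s₂, f₂, x₂, e₂, t₂⟩ := f₁.addLeaf (u := p) (v := v₂) (k := .split) (t := .spread)
    (G' := ⟨G.nodes ++ [v₁, v₂], G.edges ++ [⟨p, v₁, .split⟩, ⟨p, v₂, .split⟩], G.sources,
      L ++ v₁ :: v₂ :: R⟩)
    (by simp [hp]) (by simp [v₂]) (by rw [x₁.stage_old p hp]; exact hstep) (by simp) (by simp) rfl
  have hm₁ : v₁ ∈ G.nodes ++ [v₁] := by simp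
  rw [x₁.lab_old p hp] at x₂ e₂
  refine ⟨v₁, v₂, l₂, s₂, f₂, x₁.trans x₂ f₁.src_mem, rfl, hne, ?_⟩
  rintro v (rfl | rfl)
  · exact ⟨hf₁, by simp, rfl, by rw [x₂.lab_old _ hm₁, e₁], by rw [x₂.stage_old _ hm₁, t₁]⟩
  · exact ⟨hf₂, by simp, rfl, e₂, t₂⟩

theorem StagedForest.splits (k : ℕ) : ∀ {G : Graph} {lab : Node → Node} {st : Node → Stage}
    (_ : StagedForest G lab st) {L R : List Node} {p : Node} (_ : G.sinks = L ++ p :: R)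
    (_ : ∀ n ∈ G.sinks, n ∈ G.nodes) (_ : G.sinks.Nodup)
    (_ : st p = .levelled ∨ st p = .spread),
    ∃ G' E lab' st', (List.replicate k (Op.split L.length)).foldl Graph.record G = G' ∧
      StagedForest G' lab' st' ∧ Extension (lab p) G lab st G' lab' st' ∧
      G'.sinks = L ++ (E ++ R) ∧ E.length = k + 1 ∧
      (∀ n ∈ G'.sinks, n ∈ G'.nodes) ∧ G'.sinks.Nodup ∧
      (∀ n ∈ E, n.val = p.val ∧ lab' n = lab p) ∧
      (st p = .spread ∨ k ≠ 0 → ∀ n ∈ E, st' n = .spread) ∧ (k = 0 → G' = G ∧ E = [p]) := by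
  induction k with
  | zero =>
    intro G lab st h L R p hs hmem hnd hst
    exact ⟨G, [p], lab, st, rfl, h, .refl _ _ _ _, by simp [hs], rfl, hmem, hnd, by simp,
      by simp, by simp⟩
  | succ k ih =>
    intro G lab st h L R p hs hmem hnd hst
    have hp : p ∈ G.nodes := hmem p (by simp [hs])
    obtain ⟨v₁, v₂, l₁, s₁, f₁, x₁, e₁, hne, hv⟩ := h.split hs hp hst
    obtain ⟨hf₁, hm₁, hv₁, hl₁, hs₁⟩ := hv v₁ (.inl rfl)
    obtain ⟨hf₂, hm₂, hv₂, hl₂, hs₂⟩ := hv v₂ (.inr rfl)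
    have hmem₁ : ∀ n ∈ (G.record (.split L.length)).sinks,
        n ∈ (G.record (.split L.length)).nodes := by
      intro n hn
      rw [e₁] at hn
      by_cases hn' : n = v₁ ∨ n = v₂
      · exact (hv n hn').2.1
      · exact x₁.nodes_sub n (hmem n (by rw [hs]; grind))
    have hnd₁ : (G.record (.split L.length)).sinks.Nodup := by
      have h₁ : v₁ ∉ G.sinks := fun k => hf₁ (hmem _ k)
      have h₂ : v₂ ∉ G.sinks := fun k => hf₂ (hmem _ k)
      rw [hs] at h₁ h₂ hnd
      rw [e₁]; grind
    obtain ⟨G', E, l₂, s₂, e₂, f₂, x₂, hs', hlen, hmem', hnd', hE, hsp, -⟩ :=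
      ih f₁ e₁ hmem₁ hnd₁ (.inr hs₁)
    rw [hl₁] at x₂
    refine ⟨G', E ++ [v₂], l₂, s₂, by rw [List.replicate_succ, List.foldl_cons, e₂], f₂,
      x₁.trans x₂ f₁.src_mem, by simp [hs'], by simp [hlen], hmem', hnd', ?_, ?_, by simp⟩
    · intro n hn
      rcases List.mem_append.1 hn with hn | hn
      · have := hE n hn
        exact ⟨this.1.trans hv₁, this.2.trans hl₁⟩
      · rw [List.mem_singleton.1 hn]
        exact ⟨hv₂, (x₂.lab_old _ hm₂).trans hl₂⟩
    · intro _ n hn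
      rcases List.mem_append.1 hn with hn | hn
      · exact hsp (.inl hs₁) n hn
      · rw [List.mem_singleton.1 hn]
        exact (x₂.stage_old _ hm₂).trans hs₂

/-- The sink `s` is moved to the value `q` and then split `k` times. -/
def levelOps (q : ℝ) (i : ℕ) (s : Node) (k : ℕ) : List Op :=
  .move i (q - s.val) :: List.replicate k (.split i)

theorem cost_levelOps (c q : ℝ) (i : ℕ) (s : Node) (k : ℕ) :
    cost c (levelOps q i s k) = |s.val - q| + c * k := by
  simp [cost, levelOps, Op.cost, abs_sub_comm, mul_comm]

theorem transforms_splits (l r : List ℝ) (a : ℝ) (k : ℕ) :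
    Transforms (List.replicate k (.split l.length)) (l ++ a :: r)
      (l ++ (List.replicate (k + 1) a ++ r)) := by
  induction k generalizing r with
  | zero => exact .nil _
  | succ k ih =>
    refine .cons (.split l r a) ?_
    convert ih (a :: r) using 2
    rw [List.replicate_succ' (n := k + 1)]; simp

theorem transforms_levelOps (q : ℝ) (l r : List ℝ) (s : Node) (k : ℕ) :
    Transforms (levelOps q l.length s k) (l ++ s.val :: r)
      (l ++ (List.replicate (k + 1) q ++ r)) :=
  .cons (.move' l r s.val q (q - s.val) rfl rfl rfl (by ring)) (transforms_splits l r q k)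

theorem StagedForest.levelOps {G : Graph} {lab : Node → Node} {st : Node → Stage}
    (h : StagedForest G lab st) (q : ℝ) (k : ℕ) {L R : List Node} {s : Node}
    (hs : G.sinks = L ++ s :: R) (hmem : ∀ n ∈ G.sinks, n ∈ G.nodes) (hnd : G.sinks.Nodup)
    (hst : st s = .merged) :
    ∃ G' E lab' st', (levelOps q L.length s k).foldl Graph.record G = G' ∧
      StagedForest G' lab' st' ∧ Extension (lab s) G lab st G' lab' st' ∧
      G'.sinks = L ++ (E ++ R) ∧ E.length = k + 1 ∧
      (∀ n ∈ G'.sinks, n ∈ G'.nodes) ∧ G'.sinks.Nodup ∧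
      (∀ n ∈ E, n.val = q ∧ lab' n = lab s) ∧ (k ≠ 0 → ∀ n ∈ E, st' n = .spread) ∧
      (k = 0 → ∃ v, v ≠ s ∧ E = [v] ∧ G'.edges = G.edges ++ [⟨s, v, .move⟩]) := by
  have hsn : s ∈ G.nodes := hmem s (by simp [hs])
  have e₀ := Graph.record_move (q - s.val) hs rfl
  rw [add_sub_cancel] at e₀
  set v : Node := ⟨G.nodes.length, q⟩
  have hf : v ∉ G.nodes := fun k => (h.id_lt _ k).ne rfl
  set G₁ := G.record (.move L.length (q - s.val)) with hG₁
  obtain ⟨l₁, s₁, f₁, x₁, e₁, t₁⟩ := h.addLeaf (v := v) (G' := G₁) (k := .move) (t := .levelled)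
    hsn rfl (by rw [hst]; exact .level) (by rw [e₀]) (by rw [e₀]) (by rw [e₀])
  have hs₁ : G₁.sinks = L ++ v :: R := by rw [e₀]
  have hvn : v ∈ G₁.nodes := by rw [e₀]; simp
  have hmem₁ : ∀ n ∈ G₁.sinks, n ∈ G₁.nodes := by
    intro n hn
    rw [hs₁] at hn
    by_cases hn' : n = v
    · rw [hn']; exact hvn
    · exact x₁.nodes_sub n (hmem n (by rw [hs]; grind))
  have hnd₁ : G₁.sinks.Nodup := by
    have h₁ : v ∉ G.sinks := fun k => hf (hmem _ k)
    rw [hs] at h₁ hnd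
    rw [hs₁]; grind
  obtain ⟨G', E, l₂, s₂, e₂, f₂, x₂, hs', hlen, hmem', hnd', hE, hsp, hz⟩ :=
    f₁.splits k hs₁ hmem₁ hnd₁ (.inl t₁)
  rw [e₁] at x₂ hE
  refine ⟨G', E, l₂, s₂, e₂, f₂, x₁.trans x₂ f₁.src_mem, hs', hlen, hmem', hnd', hE,
    fun hk => hsp (.inr hk), fun hk => ?_⟩
  obtain ⟨rfl, rfl⟩ := hz hk
  exact ⟨v, fun e => hf (e ▸ hsn), rfl, by rw [e₀]⟩

/-! ### Levelling and spreading the gathered points -/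

/-- The component represented by `s` has its final shape. If `s` is a source, this is a single move
edge; otherwise the component has at least two sinks, all of them produced by splits. -/
def Finished (G : Graph) (lab : Node → Node) (st : Node → Stage) (s : Node) : Prop :=
  (s ∈ G.sources ∧ ∃ v, v ≠ s ∧ (∀ n, n ∈ G.sinks ∧ lab n = s ↔ n = v) ∧
    ∀ e, e ∈ G.edges ∧ lab e.src = s ↔ e = ⟨s, v, .move⟩) ∨
  (s ∉ G.sources ∧ (∃ a ∈ G.sinks, ∃ b ∈ G.sinks, a ≠ b ∧ lab a = s ∧ lab b = s) ∧
    ∀ n ∈ G.sinks, lab n = s → st n = .spread)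

theorem Finished.extend {G G' : Graph} {lab lab' : Node → Node} {st st' : Node → Stage}
    {s s' : Node} (h : Finished G lab st s) (hx : Extension s' G lab st G' lab' st')
    (hne : s ≠ s') (hsrc : ∀ e ∈ G.edges, e.src ∈ G.nodes) (hmem : ∀ n ∈ G.sinks, n ∈ G.nodes)
    (hsinks : ∀ n, n ∈ G'.sinks ∧ lab' n = s ↔ n ∈ G.sinks ∧ lab n = s) :
    Finished G' lab' st' s := by
  have hedges : ∀ e, e ∈ G'.edges ∧ lab' e.src = s ↔ e ∈ G.edges ∧ lab e.src = s := by
    intro e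
    constructor
    · rintro ⟨he, hl⟩
      rcases hx.edges_new e he with k | k
      · exact ⟨k, (hx.lab_old _ (hsrc e k)).symm.trans hl⟩
      · exact absurd (hl.symm.trans k) hne
    · rintro ⟨he, hl⟩
      exact ⟨hx.edges_sub e he, (hx.lab_old _ (hsrc e he)).trans hl⟩
  rcases h with ⟨hs, v, hv, h₁, h₂⟩ | ⟨hs, ⟨a, ha, b, hb, hab, la, lb⟩, h₂⟩
  · exact .inl ⟨hx.sources_eq ▸ hs, v, hv, fun n => (hsinks n).trans (h₁ n),
      fun e => (hedges e).trans (h₂ e)⟩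
  · refine .inr ⟨hx.sources_eq ▸ hs, ⟨a, ((hsinks a).2 ⟨ha, la⟩).1, b, ((hsinks b).2 ⟨hb, lb⟩).1,
      hab, ((hsinks a).2 ⟨ha, la⟩).2, ((hsinks b).2 ⟨hb, lb⟩).2⟩, fun n hn hl => ?_⟩
    have := (hsinks n).1 ⟨hn, hl⟩
    exact (hx.stage_old n (hmem n this.1)).trans (h₂ n this.1 this.2)

/-- The state while the sinks of the gathered graph `A` are being levelled and spread from left to
right: `D` are the sinks already obtained, `R` are the sinks of `A` still to be treated. -/
structure Spreading (q : ℝ) (A : Graph) (root : Node → Node) (D R : List Node) (G : Graph)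
    (lab : Node → Node) (st : Node → Stage) : Prop where
  staged : StagedForest G lab st
  sources_eq : G.sources = A.sources
  sinks_eq : G.sinks = D ++ R
  sinks_mem : ∀ n ∈ G.sinks, n ∈ G.nodes
  nodup : G.sinks.Nodup
  nodes_sub : ∀ n ∈ A.nodes, n ∈ G.nodes
  lab_old : ∀ n ∈ A.nodes, lab n = root n
  stage_sink : ∀ n ∈ A.sinks, st n = .merged
  stage_old : ∀ n ∈ A.nodes, n ∉ A.sinks → st n = .gathering
  lab_mem : ∀ n ∈ G.nodes, lab n ∈ A.sinks
  rest_mem : ∀ s ∈ R, s ∈ A.sinks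
  done_lab : ∀ n ∈ D, lab n ∉ R
  done_val : ∀ n ∈ D, n.val = q
  rest_edges : ∀ s ∈ R, s ∈ A.sources → ∀ e ∈ G.edges, lab e.src ≠ s
  finished : ∀ s ∈ A.sinks, s ∉ R → Finished G lab st s

open Classical in
theorem Gathered.spreading {c q : ℝ} {A : Graph} {root : Node → Node} (h : Gathered c q A root) :
    Spreading q A root [] A.sinks A root
      (fun n => if n ∈ A.sinks then .merged else .gathering) where
  staged := by
    refine ⟨h.toForest, fun e he => ?_⟩
    simp only [h.src_notMem_sinks e he, if_false]
    split_ifs with ht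
    · rw [h.kind_of_sink e he ht]; exact .lastMerge
    · rcases h.kind e he with k | k <;> rw [k]
      · exact .merge
      · exact .move
  sources_eq := rfl
  sinks_eq := rfl
  sinks_mem := h.sinks_mem
  nodup := h.nodup_sinks
  nodes_sub _ hn := hn
  lab_old _ _ := rfl
  stage_sink n hn := by simp [hn]
  stage_old n _ hn := by simp [hn]
  lab_mem := h.root_mem
  rest_mem _ hs := hs
  done_lab := by simp
  done_val := by simp
  rest_edges s hs hss e he hl := by
    have := h.isolated e.src (h.src_mem e he) (by rw [hl]; exact hss)
    exact h.src_notMem_sinks e he (by rw [this, hl]; exact hs)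
  finished s hs hs' := absurd hs hs'

theorem Spreading.step {c q : ℝ} {A : Graph} {root : Node → Node} (hA : Gathered c q A root)
    {D R : List Node} {G : Graph} {lab : Node → Node} {st : Node → Stage} {s : Node}
    (h : Spreading q A root D (s :: R) G lab st) {k : ℕ} (hk : k = 0 ↔ s ∈ A.sources) :
    ∃ E lab' st', Spreading q A root (D ++ E) R
      ((levelOps q D.length s k).foldl Graph.record G) lab' st' ∧ E.length = k + 1 := by
  have hsA := h.rest_mem s (by simp)
  have hls : ∀ s' ∈ A.sinks, lab s' = s' := fun s' hs' =>
    (h.lab_old s' (hA.sinks_mem s' hs')).trans (hA.root_sink s' hs')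
  have hnd := h.nodup
  rw [h.sinks_eq] at hnd
  obtain ⟨G', E, lab', st', e, f, hx, hs', hlen, hmem', hnd', hE, hsp, hz⟩ :=
    h.staged.levelOps q k h.sinks_eq h.sinks_mem h.nodup (h.stage_sink s hsA)
  rw [e]
  rw [hls s hsA] at hx hE
  have hsG : ∀ n ∈ G.sinks, lab' n = lab n := fun n hn => hx.lab_old n (h.sinks_mem n hn)
  have hsR : s ∉ R := by grind
  have hDG : ∀ n ∈ D, n ∈ G.sinks := fun n hn => by rw [h.sinks_eq]; simp [hn]
  have hRG : ∀ n ∈ R, n ∈ G.sinks := fun n hn => by rw [h.sinks_eq]; simp [hn]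
  have hD : ∀ n ∈ D, lab' n ≠ s ∧ lab' n ∉ R := fun n hn => by
    have := h.done_lab n hn
    rw [hsG n (hDG n hn)]; simp at this; exact this
  have hR : ∀ n ∈ R, lab' n = n := fun n hn => by
    rw [hsG n (hRG n hn), hls n (h.rest_mem n (by simp [hn]))]
  -- the sinks in the component of `s` are those in `E`
  have hsE : ∀ n, n ∈ G'.sinks ∧ lab' n = s ↔ n ∈ E := by
    intro n
    rw [hs']
    constructor
    · rintro ⟨hn, hl⟩
      rcases List.mem_append.1 hn with hn | hn
      · exact absurd hl (hD n hn).1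
      rcases List.mem_append.1 hn with hn | hn
      · exact hn
      · rw [hR n hn] at hl; exact absurd (hl ▸ hn) hsR
    · intro hn; exact ⟨by simp [hn], (hE n hn).2⟩
  refine ⟨E, lab', st', ⟨f, hx.sources_eq.trans h.sources_eq, by rw [hs']; simp, hmem', hnd',
    fun n hn => hx.nodes_sub n (h.nodes_sub n hn),
    fun n hn => (hx.lab_old n (h.nodes_sub n hn)).trans (h.lab_old n hn),
    fun n hn => (hx.stage_old n (h.nodes_sub n (hA.sinks_mem n hn))).trans (h.stage_sink n hn),
    fun n hn hn' => (hx.stage_old n (h.nodes_sub n hn)).trans (h.stage_old n hn hn'), ?_,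
    fun s' hs' => h.rest_mem s' (by simp [hs']), ?_, ?_, ?_, ?_⟩, hlen⟩
  · intro n hn
    rcases hx.lab_new n hn with hn' | hn'
    · rw [hx.lab_old n hn']; exact h.lab_mem n hn'
    · rw [hn']; exact hsA
  · intro n hn
    rcases List.mem_append.1 hn with hn | hn
    · exact (hD n hn).2
    · rw [(hE n hn).2]; exact hsR
  · intro n hn
    rcases List.mem_append.1 hn with hn | hn
    · exact h.done_val n hn
    · exact (hE n hn).1
  · intro s' hs' hss e he hl
    rcases hx.edges_new e he with he' | he'
    · rw [hx.lab_old _ (h.staged.src_mem e he')] at hl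
      exact h.rest_edges s' (by simp [hs']) hss e he' hl
    · rw [hl] at he'; exact hsR (he' ▸ hs')
  · intro s' hs'A hs'R
    by_cases hss : s' = s
    · subst hss
      by_cases hk0 : k = 0
      · obtain ⟨v, hv, hEv, hed⟩ := hz hk0
        have hsrc := hk.1 hk0
        refine .inl ⟨by rw [hx.sources_eq, h.sources_eq]; exact hsrc, v, hv,
          fun n => by rw [hsE, hEv, List.mem_singleton], fun e => ?_⟩
        rw [hed]
        constructor
        · rintro ⟨he, hl⟩
          rcases List.mem_append.1 he with he | he
          · rw [hx.lab_old _ (h.staged.src_mem e he)] at hl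
            exact absurd hl (h.rest_edges s' (by simp) hsrc e he)
          · exact List.mem_singleton.1 he
        · rintro rfl
          refine ⟨by simp, ?_⟩
          show lab' s' = s'
          rw [hsG s' (by rw [h.sinks_eq]; simp), hls s' hsA]
      · refine .inr ⟨by rw [hx.sources_eq, h.sources_eq]; exact fun k' => hk0 (hk.2 k'), ?_,
          fun n hn hl => hsp hk0 n ((hsE n).1 ⟨hn, hl⟩)⟩
        obtain _ | ⟨a, _ | ⟨b, E'⟩⟩ := E
        · simp at hlen
        · simp at hlen; omega
        · have ha := (hsE a).2 (by simp)
          have hb := (hsE b).2 (by simp)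
          refine ⟨a, ha.1, b, hb.1, ?_, ha.2, hb.2⟩
          rw [hs'] at hnd'
          grind
    · refine (h.finished s' hs'A (by simp [hss, hs'R])).extend hx hss h.staged.src_mem
        h.sinks_mem (fun n => ?_)
      rw [hs', h.sinks_eq]
      constructor
      · rintro ⟨hn, hl⟩
        rcases List.mem_append.1 hn with hn | hn
        · exact ⟨by simp [hn], by rw [← hsG n (hDG n hn), hl]⟩
        rcases List.mem_append.1 hn with hn | hn
        · rw [(hE n hn).2] at hl; exact absurd hl.symm hss
        · exact ⟨by simp [hn], by rw [← hsG n (hRG n hn), hl]⟩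
      · rintro ⟨hn, hl⟩
        have hl' := (hsG n (by rw [h.sinks_eq]; exact hn)).trans hl
        have hns : n ≠ s := fun e => hss (by rw [← hl, e, hls s hsA])
        exact ⟨by grind, hl'⟩

theorem Spreading.exists_final {c q : ℝ} {A : Graph} {root : Node → Node}
    (hA : Gathered c q A root) {k : Node → ℕ}
    (hk : ∀ s ∈ A.sinks, k s = 0 ↔ s ∈ A.sources) :
    ∀ {R D : List Node} {G : Graph} {lab : Node → Node} {st : Node → Stage},
      Spreading q A root D R G lab st →
      ∃ T D' lab' st', Spreading q A root D' [] (T.foldl Graph.record G) lab' st' ∧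
        Transforms T (G.sinks.map Node.val) (D'.map Node.val) ∧
        cost c T = (R.map fun s => |s.val - q| + c * k s).sum ∧
        D'.length = D.length + (R.map fun s => k s + 1).sum := by
  intro R
  induction R with
  | nil =>
    intro D G lab st h
    refine ⟨[], D, lab, st, h, ?_, by simp [cost], by simp⟩
    rw [h.sinks_eq, List.append_nil]; exact .nil _
  | cons s R ih =>
    intro D G lab st h
    obtain ⟨E, lab₁, st₁, h₁, hlen⟩ := h.step hA (hk s (h.rest_mem s (by simp)))
    obtain ⟨T, D', lab', st', h', ht, hcost, hlen'⟩ := ih h₁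
    refine ⟨levelOps q D.length s (k s) ++ T, D', lab', st', ?_, ?_, ?_, ?_⟩
    · rw [List.foldl_append]; exact h'
    · have hEq : E.map Node.val = List.replicate (k s + 1) q := by
        rw [List.eq_replicate_iff]
        refine ⟨by simp [hlen], fun b hb => ?_⟩
        obtain ⟨n, hn, rfl⟩ := List.mem_map.1 hb
        exact h₁.done_val n (by simp [hn])
      have := transforms_levelOps q (D.map Node.val) (R.map Node.val) s (k s)
      rw [List.length_map] at this
      rw [h₁.sinks_eq] at ht
      rw [h.sinks_eq]
      refine Transforms.append ?_ ht
      simpa [hEq] using this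
    · rw [cost_append, cost_levelOps, hcost]; simp
    · rw [hlen', List.length_append, hlen]; simp; ring

/-! ### The components of the final graph -/

/-- In the final graph, a component is a Type-1-Tree or a Type-4-Tree depending on whether its
representative is a source. -/
theorem Spreading.isTree {c q : ℝ} (hc : 0 ≤ c) {A G : Graph} {root : Node → Node}
    (hA : Gathered c q A root) {D : List Node} {lab : Node → Node} {st : Node → Stage}
    (h : Spreading q A root D [] G lab st) {u : Node} (hu : u ∈ G.nodes) :
    (G.IsType4Tree (G.component u) ∧
      ((∀ v ∈ G.sourcesIn (G.component u), v.val ≤ q - 2 * c) ∨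
        (∀ v ∈ G.sourcesIn (G.component u), q + 2 * c ≤ v.val)) ∧
      1 < (G.sourcesIn (G.component u)).ncard) ∨
    G.IsType1Tree (G.component u) := by
  have hF := h.staged.toForest
  have hsup : ∀ v ∈ G.nodes, v ∈ (G.component u).supp ↔ lab v = lab u :=
    fun v hv => hF.mem_component_iff hu hv
  have hsA := h.lab_mem u hu
  have hsrc : ∀ v, v ∈ G.sourcesIn (G.component u) ↔ v ∈ A.sources ∧ root v = lab u := by
    intro v
    simp only [Graph.sourcesIn, Set.mem_ofPred_eq, h.sources_eq]
    refine and_congr_right fun hv => ?_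
    have hv' := hA.sources_mem v hv
    rw [hsup v (h.nodes_sub v hv'), h.lab_old v hv']
  have hsnk : ∀ v, v ∈ G.sinksIn (G.component u) ↔ v ∈ G.sinks ∧ lab v = lab u := by
    intro v
    simp only [Graph.sinksIn, Set.mem_ofPred_eq]
    exact and_congr_right fun hv => hsup v (h.sinks_mem v hv)
  have hedg : ∀ e, e ∈ G.edgesIn (G.component u) ↔ e ∈ G.edges ∧ lab e.src = lab u := by
    intro e
    simp only [Graph.edgesIn, Set.mem_ofPred_eq]
    exact and_congr_right fun he => hsup _ (hF.src_mem e he)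
  generalize lab u = s at hsup hsA hsrc hsnk hedg
  rcases h.finished s hsA (by simp) with ⟨hs, v, hv, h₁, h₂⟩ | ⟨hs, ⟨a, ha, b, hb, hab, la, lb⟩, h₂⟩
  · right
    rw [h.sources_eq] at hs
    have hsing : ∀ w, w ∈ G.sourcesIn (G.component u) ↔ w = s := by
      intro w
      rw [hsrc]
      constructor
      · rintro ⟨hw, hr⟩
        rw [hA.isolated w (hA.sources_mem w hw) (hr ▸ hs), hr]
      · rintro rfl; exact ⟨hs, hA.root_sink _ hsA⟩
    have hvs : ∀ w, w ∈ G.sinksIn (G.component u) ↔ w = v := fun w => (hsnk w).trans (h₁ w)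
    refine ⟨hF.isTree _, ?_, s, v, Set.ext hsing, Set.ext hvs,
      Set.ext fun e => (hedg e).trans (h₂ e)⟩
    intro a ha b hb ks p
    rw [hsing] at ha
    rw [hvs] at hb
    subst ha hb
    have hlab : lab a = a :=
      (h.lab_old a (hA.sinks_mem a hsA)).trans (hA.root_sink a hsA)
    have hlabv : lab b = a := ((h₁ b).2 rfl).2
    cases p with
    | nil => exact absurd rfl hv
    | cons he p =>
      have := (h₂ _).1 ⟨he, hlab⟩
      simp only [Edge.mk.injEq, true_and] at this
      obtain ⟨rfl, rfl⟩ := this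
      cases p with
      | nil => simp [IsType1Path]
      | cons he p =>
        have := (h₂ _).1 ⟨he, hlabv⟩
        simp only [Edge.mk.injEq] at this
        exact absurd this.1 hv
  · left
    rw [h.sources_eq] at hs
    obtain ⟨a', ha', b', hb', hab', ra, rb⟩ := hA.two_sources s hsA hs
    have hfin : (G.sourcesIn (G.component u)).Finite :=
      (List.finite_toSet A.sources).subset fun v hv => ((hsrc v).1 hv).1
    have hfin' : (G.sinksIn (G.component u)).Finite :=
      (List.finite_toSet G.sinks).subset fun v hv => ((hsnk v).1 hv).1
    have hcard : 1 < (G.sourcesIn (G.component u)).ncard :=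
      (Set.one_lt_ncard hfin).2 ⟨a', (hsrc a').2 ⟨ha', ra⟩, b', (hsrc b').2 ⟨hb', rb⟩, hab'⟩
    have hcard' : 1 < (G.sinksIn (G.component u)).ncard :=
      (Set.one_lt_ncard hfin').2 ⟨a, (hsnk a).2 ⟨ha, la⟩, b, (hsnk b).2 ⟨hb, lb⟩, hab⟩
    have hne : ∀ w ∈ A.sources, root w = s → w ≠ s := fun w hw _ e => hs (e ▸ hw)
    have hside : ∀ w ∈ A.sources, root w = s → 0 < excess c q w.val * excess c q s.val := by
      intro w hw hr
      rcases hA.side w hw with k | k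
      · exact absurd (k.trans hr) (hne w hw hr)
      · rwa [hr] at k
    refine ⟨⟨hF.isTree _, ?_, hcard, hcard'⟩, ?_, hcard⟩
    · intro x hx y hy ks p
      obtain ⟨hx, hr⟩ := (hsrc x).1 hx
      obtain ⟨hy, hl⟩ := (hsnk y).1 hy
      have hxs : x ∉ A.sinks := fun k => hne x hx hr ((hA.root_sink x k).symm.trans hr)
      obtain ⟨as, bs, e, has, hbs⟩ := (h.staged.path_kinds p (h₂ y hy hl)).2.2.2
        (h.stage_old x (hA.sources_mem x hx) hxs)
      exact ⟨as, bs, e, has, fun k hk => .inl (hbs k hk)⟩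
    · rcases side_of_excess_mul_pos hc (hside a' ha' ra) with ⟨-, k⟩ | ⟨-, k⟩
      · right
        intro w hw
        obtain ⟨hw, hr⟩ := (hsrc w).1 hw
        rcases side_of_excess_mul_pos hc (hside w hw hr) with k' | k' <;> linarith
      · left
        intro w hw
        obtain ⟨hw, hr⟩ := (hsrc w).1 hw
        rcases side_of_excess_mul_pos hc (hside w hw hr) with k' | k' <;> linarith

open Classical in
/-- The number of splits that gives each component as many sinks as it has sources. -/
theorem Gathered.exists_splits {c q : ℝ} {A : Graph} {root : Node → Node}
    (hA : Gathered c q A root) :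
    ∃ k : Node → ℕ, (∀ s ∈ A.sinks, k s = 0 ↔ s ∈ A.sources) ∧
      (A.sinks.map fun s => k s + 1).sum = A.sources.length := by
  have hone : ∀ s ∈ A.sinks, 1 ≤ (A.sources.toFinset.filter (root · = s)).card := by
    intro s hs
    obtain ⟨a, ha, e⟩ := hA.exists_source hs
    exact Finset.card_pos.2 ⟨a, by simp [ha, e]⟩
  refine ⟨fun s => (A.sources.toFinset.filter (root · = s)).card - 1, fun s hs => ?_, ?_⟩
  · constructor
    · intro h0
      by_contra hss
      obtain ⟨a, ha, b, hb, hab, ea, eb⟩ := hA.two_sources s hs hss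
      have : 1 < (A.sources.toFinset.filter (root · = s)).card :=
        Finset.one_lt_card.2 ⟨a, by simp [ha, ea], b, by simp [hb, eb], hab⟩
      exact absurd (Nat.sub_eq_zero_iff_le.1 h0) (not_le.2 this)
    · intro hss
      have : A.sources.toFinset.filter (root · = s) = {s} := by
        ext a
        simp only [Finset.mem_filter, List.mem_toFinset, Finset.mem_singleton]
        constructor
        · rintro ⟨ha, hr⟩
          rw [hA.isolated a (hA.sources_mem a ha) (hr ▸ hss), hr]
        · rintro rfl; exact ⟨hss, hA.root_sink _ hs⟩
      simp [this]
  · have hmap : (A.sinks.map fun s => (A.sources.toFinset.filter (root · = s)).card - 1 + 1) =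
        A.sinks.map fun s => (A.sources.toFinset.filter (root · = s)).card :=
      List.map_congr_left fun s hs => Nat.sub_add_cancel (hone s hs)
    rw [hmap, ← List.sum_toFinset _ hA.nodup_sinks,
      ← Finset.card_eq_sum_card_fiberwise (f := root) (s := A.sources.toFinset)
        (t := A.sinks.toFinset), List.toFinset_card_of_nodup hA.nodup_sources]
    intro a ha
    have : a ∈ A.sources := by simpa using ha
    simpa using hA.root_mem a (hA.sources_mem a this)

end MSM

end

theorem mainTheorem2 (c q : ℝ) (hc : 0 ≤ c) (x : List ℝ) :
    ∃ S : List MSM.Op,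
      MSM.IsOptimal c S x (List.replicate x.length q) ∧
      let G : MSM.Graph := MSM.transformationGraph x S
      ∀ u ∈ G.nodes,
        (G.IsType4Tree (G.component u) ∧
          ((∀ v ∈ G.sourcesIn (G.component u), v.val ≤ q - 2 * c) ∨
            (∀ v ∈ G.sourcesIn (G.component u), q + 2 * c ≤ v.val)) ∧
          1 < (G.sourcesIn (G.component u)).ncard) ∨
        G.IsType1Tree (G.component u) := by
  obtain ⟨S, root, h, hchain⟩ := MSM.exists_gathersTo hc q x
  obtain ⟨k, hk, hsum⟩ := h.gathered.exists_splits
  obtain ⟨T, D, lab, st, hD, hT, hcost, hlen⟩ :=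
    MSM.Spreading.exists_final h.gathered hk h.gathered.spreading
  rw [← MSM.transformationGraph_append] at hD
  refine ⟨S ++ T, ⟨?_, fun S' hS' => ?_⟩, fun u hu => hD.isTree hc h.gathered hu⟩
  · have : D.map MSM.Node.val = List.replicate x.length q := by
      rw [List.eq_replicate_iff]
      refine ⟨by simp [hlen, hsum, h.sources_length], fun b hb => ?_⟩
      obtain ⟨n, hn, rfl⟩ := List.mem_map.1 hb
      exact hD.done_val n hn
    rw [← this]
    exact h.transforms.append hT
  · refine le_trans (le_of_eq ?_) (MSM.potential_le_cost hc hS')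
    have hpot := h.cost_eq
    rw [MSM.potential_of_isChain hc hchain, List.map_map] at hpot
    have hsum' : ((MSM.transformationGraph x S).sinks.map fun s => c * (k s : ℝ)).sum =
        c * (x.length - (MSM.transformationGraph x S).sinks.length) := by
      rw [List.sum_map_mul_left, ← h.sources_length, ← hsum, List.sum_map_add]
      simp [Nat.cast_list_sum, Function.comp_def]
    rw [MSM.cost_append, hcost, List.sum_map_add, hsum', ← hpot]
    simp only [Function.comp_def]
    ring
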